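/- Let $d\ge 2$ and let $Q$ be a positive definite quadratic form on $\mathbb R^d$. For $\lambda\ge 1$ and $\lambda^{-1}\le\delta<1$ let $S_{\lambda,\delta}=\{x\in\mathbb R^d:|\sqrt{Q(x)}-\lambda|<\delta\}$. A cap is a set of the form $\theta=\{x\in S_{\lambda,\delta}:|x-x_\theta|<\sqrt{\lambda\delta}\}$ with $x_\theta\in S_{\lambda,\delta}$, where $|\cdot|$ is the Euclidean norm; let $N_\theta=\#(\theta\cap\mathbb Z^d)$. Let $\mathcal C$ be a collection of caps whose union is $S_{\lambda,\delta}$ and which is almost disjoint, in the sense that no point lies in more than $M$ of the caps. Put $\mathcal C_0=\{\theta\in\mathcal C: N_\theta<(\sqrt{\lambda\delta})^{d-1}\delta\}$ and, for integers $j\ge 1$, $$\mathcal C_j=\{\theta\in\mathcal C:\ (\sqrt{\lambda\delta})^{d-1}\delta\,2^{j-1}<N_\theta\le(\sqrt{\lambda\delta})^{d-1}\delta\,2^{j}\}.$$ There is a constant $K>0$ depending only on $d$ and $Q$, and for every $M\in\mathbb N$ there is a constant $C>0$ depending only on $d$, $Q$ and $M$, such that the following holds for all $\lambda,\delta,\mathcal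 C$ as above. Let $k\in\{1,\dots,d-1\}$ and let $j\ge 0$ be an integer. If $2^j>K$ and $(\sqrt{\delta\lambda})^k\,\delta\, 2^j>K$, then $\mathcal C_j$ is finite and $$\#\mathcal C_j\le C\,(2^{j/k}\delta)^{-d}.$$ Consequently, there is a constant $C'>0$ depending only on $d$ and $Q$ such that $$\#(S_{\lambda,\delta}\cap\mathbb Z^d)\le C'\Big(\delta\lambda^{d-1}+\big(\sqrt{\lambda/\delta}\big)^{d-1}\Big)\qquad(\lambda\ge 1,\ \lambda^{-1}\le\delta<1),$$ and Landau's bound for thin shells holds: there is a constant $C''>0$ depending only on $d$ and $Q$ such that $$\#(S_{\lambda,\delta}\cap\mathbb Z^d)\le C''\,\delta\lambda^{d-1}\qquad(\lambda\ge 1,\ \lambda^{-\frac{d-1}{d+1}}<\delta<1).$$ -/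

import Mathlib

noncomputable section

namespace ThinShell

/-- The space `ℝ^d` with its Euclidean norm. -/
abbrev E (d : ℕ) : Type := EuclideanSpace ℝ (Fin d)

/-- The set `ℤ^d` of points of `ℝ^d` with integer coordinates. -/
def integerPoints (d : ℕ) : Set (E d) :=
  {x | ∀ i, ∃ n : ℤ, x i = (n : ℝ)}

/-- The shell of points `x` with `|√Q(x) - lam| < del`. -/
def shell {d : ℕ} (Q : QuadraticForm ℝ (E d)) (lam del : ℝ) : Set (E d) :=
  {x | |√(Q x) - lam| < del}

/-- The cap with centre `c`: the part of the shell at Euclidean distance less than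
`√(lam * del)` from `c`. -/
def cap {d : ℕ} (Q : QuadraticForm ℝ (E d)) (lam del : ℝ) (c : E d) : Set (E d) :=
  Metric.ball c (√(lam * del)) ∩ shell Q lam del

/-- `𝒞` is a collection of caps, centred at points of the shell, whose union is the shell and
which is almost disjoint in the sense that no point lies in more than `M` of the caps. -/
structure IsCapDecomposition {d : ℕ} (Q : QuadraticForm ℝ (E d)) (lam del : ℝ) (M : ℕ)
    (𝒞 : Set (Set (E d))) : Prop where
  isCap : ∀ θ ∈ 𝒞, ∃ c ∈ shell Q lam del, θ = cap Q lam del c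
  sUnion_eq : ⋃₀ 𝒞 = shell Q lam del
  overlap : ∀ x : E d, {θ ∈ 𝒞 | x ∈ θ}.encard ≤ M

/-- The number of integer points in `θ` (only used for bounded `θ`). -/
def latticeCount {d : ℕ} (θ : Set (E d)) : ℕ :=
  (integerPoints d ∩ θ).ncard

/-- The class `𝒞_j` of those caps in `𝒞` that contain about `2 ^ j * (√(lam * del)) ^ (d - 1) * del`
integer points. -/
def capClass {d : ℕ} (lam del : ℝ) (𝒞 : Set (Set (E d))) : ℕ → Set (Set (E d))
  | 0 => {θ ∈ 𝒞 | (latticeCount θ : ℝ) < √(lam * del) ^ (d - 1) * del}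
  | j + 1 => {θ ∈ 𝒞 | √(lam * del) ^ (d - 1) * del * 2 ^ j < (latticeCount θ : ℝ) ∧
      (latticeCount θ : ℝ) ≤ √(lam * del) ^ (d - 1) * del * 2 ^ (j + 1)}

end ThinShell

end

noncomputable section

namespace ThinShell

open scoped InnerProductSpace

/-- The point of `ℤ^d ⊆ ℝ^d` with given integer coordinates. -/
def intVec {d : ℕ} (z : Fin d → ℤ) : E d := WithLp.toLp 2 (fun i => (z i : ℝ))

@[simp] lemma intVec_apply {d : ℕ} (z : Fin d → ℤ) (i : Fin d) : intVec z i = z i := rfl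

@[simp] lemma intVec_zero {d : ℕ} : intVec (0 : Fin d → ℤ) = 0 := by
  ext i; simp

lemma intVec_sub {d : ℕ} (y z : Fin d → ℤ) : intVec (y - z) = intVec y - intVec z := by
  ext i; simp

lemma intVec_neg {d : ℕ} (z : Fin d → ℤ) : intVec (-z) = -intVec z := by
  ext i; simp

lemma intVec_injective {d : ℕ} : Function.Injective (intVec (d := d)) := by
  intro y z h
  ext i
  have := congrArg (fun x : E d => x i) h
  simpa using this

lemma mem_integerPoints_iff {d : ℕ} {x : E d} : x ∈ integerPoints d ↔ ∃ z, intVec z = x := by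
  constructor
  · intro h
    choose z hz using h
    exact ⟨z, by ext i; simp [hz]⟩
  · rintro ⟨z, rfl⟩ i
    exact ⟨z i, rfl⟩

lemma abs_coord_le_norm {d : ℕ} (x : E d) (i : Fin d) : |x i| ≤ ‖x‖ := by
  simpa using PiLp.norm_apply_le x i

lemma one_le_norm_intVec {d : ℕ} {z : Fin d → ℤ} (hz : z ≠ 0) : 1 ≤ ‖intVec z‖ := by
  obtain ⟨i, hi⟩ := Function.ne_iff.mp hz
  refine le_trans ?_ (abs_coord_le_norm (intVec z) i)
  rw [intVec_apply, ← Int.cast_abs]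
  exact_mod_cast Int.one_le_abs hi

lemma finite_norm_intVec_le (d : ℕ) (r : ℝ) : {z : Fin d → ℤ | ‖intVec z‖ ≤ r}.Finite := by
  refine (Set.Finite.pi' (t := fun _ => Set.Icc (-⌊r⌋) ⌊r⌋) fun _ => Set.finite_Icc _ _).subset ?_
  intro z hz i
  have h := (abs_coord_le_norm (intVec z) i).trans hz
  rw [intVec_apply, ← Int.cast_abs] at h
  have h' : |z i| ≤ ⌊r⌋ := Int.le_floor.mpr h
  exact abs_le.mp h'

lemma finite_norm_map_intVec_le {d : ℕ} (L : E d ≃ₗ[ℝ] E d) (r : ℝ) :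
    {z : Fin d → ℤ | ‖L (intVec z)‖ ≤ r}.Finite := by
  obtain ⟨K, -, hK⟩ := L.toLinearMap.exists_antilipschitzWith L.ker
  refine (finite_norm_intVec_le d (K * r)).subset fun z hz => ?_
  have h := ZeroHomClass.bound_of_antilipschitz L.toLinearMap hK (intVec z)
  exact h.trans (mul_le_mul_of_nonneg_left hz K.2)

/-! ### Determinants of families of vectors -/

/-- The determinant of a family of vectors, in the standard basis. -/
def vdet {d : ℕ} (v : Fin d → E d) : ℝ := (Matrix.of fun i j => v i j).det

lemma vdet_eq {d : ℕ} (v : Fin d → E d) :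
    vdet v = (EuclideanSpace.basisFun (Fin d) ℝ).toBasis.det v := by
  rw [Module.Basis.det_apply, vdet, ← Matrix.det_transpose]
  congr 1

/-- Hadamard's inequality, read off from the volume form of an orientation. -/
lemma abs_vdet_le {d : ℕ} (v : Fin d → E d) : |vdet v| ≤ ∏ i, ‖v i‖ := by
  have : Fact (Module.finrank ℝ (E d) = d) := ⟨by simp⟩
  rw [vdet_eq, ← Orientation.volumeForm_robust'
    (EuclideanSpace.basisFun (Fin d) ℝ).toBasis.orientation]
  exact Orientation.abs_volumeForm_apply_le _ v

lemma vdet_map {d : ℕ} (L : E d →ₗ[ℝ] E d) (v : Fin d → E d) :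
    vdet (fun i => L (v i)) = LinearMap.det L * vdet v := by
  rw [vdet_eq, vdet_eq, ← Module.Basis.det_comp]
  rfl

lemma vdet_intVec {d : ℕ} (z : Fin d → Fin d → ℤ) :
    vdet (fun i => intVec (z i)) = ((Matrix.of z).det : ℤ) := by
  exact (Int.cast_det _).symm

lemma one_le_abs_vdet_intVec {d : ℕ} {z : Fin d → Fin d → ℤ}
    (hz : LinearIndependent ℝ fun i => intVec (z i)) :
    1 ≤ |vdet fun i => intVec (z i)| := by
  have h : vdet (fun i => intVec (z i)) ≠ 0 := by
    rw [vdet]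
    have : LinearIndependent ℝ (Matrix.of fun i j => intVec (z i) j).row := by
      exact hz.map' (WithLp.linearEquiv 2 ℝ (Fin d → ℝ)).toLinearMap (LinearEquiv.ker _)
    rw [Matrix.linearIndependent_rows_iff_isUnit, Matrix.isUnit_iff_isUnit_det] at this
    exact this.ne_zero
  rw [vdet_intVec] at h ⊢
  have h' := Int.one_le_abs (by exact_mod_cast h : (Matrix.of z).det ≠ 0)
  exact_mod_cast h'

lemma span_intVec (d : ℕ) : Submodule.span ℝ (Set.range (intVec (d := d))) = ⊤ := by
  rw [eq_top_iff, ← (EuclideanSpace.basisFun (Fin d) ℝ).toBasis.span_eq]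
  refine Submodule.span_mono ?_
  rintro _ ⟨i, rfl⟩
  refine ⟨Pi.single i 1, ?_⟩
  ext j
  by_cases h : j = i <;> simp [h]

/-! ### Reduced systems and lattice points in balls -/

/-- Integer vectors realizing the successive minima of a lattice. -/
lemma exists_successive_minima {d : ℕ} (L : E d ≃ₗ[ℝ] E d) (n : ℕ) (hn : n ≤ d) :
    ∃ z : Fin n → Fin d → ℤ, LinearIndependent ℝ (fun i => intVec (z i)) ∧
      ∀ i y, intVec y ∉ Submodule.span ℝ {v | ∃ l < i, v = intVec (z l)} →
        ‖L (intVec (z i))‖ ≤ ‖L (intVec y)‖ := by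
  induction n with
  | zero => exact ⟨fun i => i.elim0, linearIndependent_empty_type, fun i => i.elim0⟩
  | succ n ih =>
    obtain ⟨z, hz, hmin⟩ := ih (by omega)
    set S := Submodule.span ℝ (Set.range fun i => intVec (z i)) with hS
    obtain ⟨y₀, hy₀⟩ : ∃ y, intVec y ∉ S := by
      by_contra! h
      have htop : S = ⊤ := by
        rw [eq_top_iff, ← span_intVec, Submodule.span_le]
        rintro _ ⟨y, rfl⟩
        exact h y
      have h1 := finrank_span_eq_card hz
      rw [← hS, htop, finrank_top] at h1
      simp at h1
      omega
    -- Greedy choice: a shortest integer vector outside the span so far. The cutoff at `y₀` makes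
    -- the competition finite.
    obtain ⟨y, hy, hymin⟩ := Set.exists_min_image
      {y : Fin d → ℤ | intVec y ∉ S ∧ ‖L (intVec y)‖ ≤ ‖L (intVec y₀)‖}
      (fun y => ‖L (intVec y)‖) ((finite_norm_map_intVec_le L _).subset fun y hy => hy.2)
      ⟨y₀, hy₀, le_rfl⟩
    have hmin' : ∀ x, intVec x ∉ S → ‖L (intVec y)‖ ≤ ‖L (intVec x)‖ := by
      intro x hx
      by_cases h : ‖L (intVec x)‖ ≤ ‖L (intVec y₀)‖
      · exact hymin x ⟨hx, h⟩
      · exact hy.2.trans (le_of_not_ge h)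
    refine ⟨Fin.snoc z y, ?_, ?_⟩
    · have : (fun i => intVec ((Fin.snoc z y : Fin (n + 1) → Fin d → ℤ) i)) =
          Fin.snoc (fun i => intVec (z i)) (intVec y) := by
        ext1 i
        refine Fin.lastCases ?_ (fun i => ?_) i <;> simp
      rw [this, linearIndependent_finSnoc]
      exact ⟨hz, hy.1⟩
    · intro i
      refine Fin.lastCases ?_ (fun i => ?_) i
      · intro x hx
        simp only [Fin.snoc_last]
        refine hmin' x fun h => hx (Submodule.span_mono ?_ h)
        rintro _ ⟨l, rfl⟩
        exact ⟨l.castSucc, Fin.castSucc_lt_last l, by simp⟩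
      · intro x hx
        simp only [Fin.snoc_castSucc]
        refine hmin i x fun h => hx (Submodule.span_mono ?_ h)
        rintro _ ⟨l, hl, rfl⟩
        exact ⟨l.castSucc, Fin.castSucc_lt_castSucc_iff.mpr hl, by simp⟩

/-- A reduced system of integer vectors for the lattice `L ℤ^d`, with an orthonormal basis in whose
coordinates nonzero lattice points stay away from the origin. -/
lemma exists_reduced {d : ℕ} (L : E d ≃ₗ[ℝ] E d) :
    ∃ (z : Fin d → Fin d → ℤ) (u : OrthonormalBasis (Fin d) ℝ (E d)),
      LinearIndependent ℝ (fun i => intVec (z i)) ∧ Monotone (fun i => ‖L (intVec (z i))‖) ∧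
      ∀ y ≠ 0, ∃ l, ‖L (intVec (z l))‖ ≤ d * |⟪u l, L (intVec y)⟫_ℝ| := by
  obtain ⟨z, hz, hmin⟩ := exists_successive_minima L d le_rfl
  have hmono : Monotone (fun i => ‖L (intVec (z i))‖) := by
    intro i j hij
    refine hmin i (z j) ?_
    have := hz.notMem_span_image (s := {l | l < i}) (x := j) (by simpa using hij)
    convert this using 3
    ext v
    simp [eq_comm]
  let u := InnerProductSpace.gramSchmidtOrthonormalBasis (𝕜 := ℝ) (E := E d) (by simp)
    (fun i => L (intVec (z i)))
  have hu : ∀ i j, i < j → ⟪u j, L (intVec (z i))⟫_ℝ = 0 := fun i j hij =>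
    InnerProductSpace.gramSchmidtOrthonormalBasis_inv_triangular _ _ hij
  refine ⟨z, u, hz, hmono, fun y hy => ?_⟩
  by_contra! hlt
  have hLy : L (intVec y) ≠ 0 := by
    rw [Ne, LinearEquiv.map_eq_zero_iff, ← intVec_zero]
    exact fun h => hy (intVec_injective h)
  -- At the last nonzero Gram–Schmidt coordinate `i`, `y` is outside the span of the earlier `z l`,
  -- so `‖L y‖` is at least the `i`-th size. If every coordinate were below its size divided by `d`,
  -- monotonicity would make `‖L y‖` smaller than that.
  obtain ⟨i, hi, himax⟩ : ∃ i, ⟪u i, L (intVec y)⟫_ℝ ≠ 0 ∧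
      ∀ l, i < l → ⟪u l, L (intVec y)⟫_ℝ = 0 := by
    have hne : ({l | ⟪u l, L (intVec y)⟫_ℝ ≠ 0} : Set (Fin d)).Nonempty := by
      by_contra h
      rw [Set.not_nonempty_iff_eq_empty] at h
      refine hLy (InnerProductSpace.ext_inner_left_basis u.toBasis fun l => ?_)
      have : l ∉ ({l | ⟪u l, L (intVec y)⟫_ℝ ≠ 0} : Set (Fin d)) := by rw [h]; simp
      simpa using this
    obtain ⟨i, hi, h⟩ := Set.exists_max_image _ id (Set.toFinite _) hne
    refine ⟨i, hi, fun l hl => ?_⟩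
    by_contra h'
    exact absurd (h l h') (not_le.mpr hl)
  have hle : ‖L (intVec (z i))‖ ≤ ‖L (intVec y)‖ := by
    refine hmin i y fun hmem => hi ?_
    generalize intVec y = x at hmem
    induction hmem using Submodule.span_induction with
    | mem v hv => obtain ⟨l, hl, rfl⟩ := hv; exact hu l i hl
    | zero => simp
    | add v w _ _ hv hw => rw [map_add, inner_add_right, hv, hw, add_zero]
    | smul c v _ hv => rw [map_smul, inner_smul_right, hv, mul_zero]
  have hd : 0 < d := i.pos
  have hd' : (1 : ℝ) ≤ d := by exact_mod_cast hd
  have hpos : 0 < ‖L (intVec (z i))‖ := by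
    refine lt_of_le_of_lt (by positivity) (hlt i)
  set μ := ‖L (intVec (z i))‖
  have hterm : ∀ l ∈ Finset.univ, ⟪u l, L (intVec y)⟫_ℝ ^ 2 ≤ (μ / d) ^ 2 := by
    intro l _
    rw [← sq_abs]
    by_cases hl : i < l
    · rw [himax l hl]; simp; positivity
    · have h1 := (hlt l).le.trans (hmono (not_lt.mp hl))
      gcongr
      rw [le_div_iff₀ (by positivity), mul_comm]
      exact h1
  have hlt' : ∑ l, ⟪u l, L (intVec y)⟫_ℝ ^ 2 < ∑ _l : Fin d, (μ / d) ^ 2 := by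
    refine Finset.sum_lt_sum hterm ⟨i, Finset.mem_univ i, ?_⟩
    rw [← sq_abs]
    gcongr
    rw [lt_div_iff₀ (by positivity), mul_comm]
    exact hlt i
  rw [u.sum_sq_inner_right] at hlt'
  simp only [Finset.sum_const, Finset.card_univ, Fintype.card_fin, nsmul_eq_mul] at hlt'
  have h2 : (d : ℝ) * (μ / d) ^ 2 ≤ μ ^ 2 := by
    rw [div_pow, ← mul_div_assoc, div_le_iff₀ (by positivity)]
    nlinarith [sq_nonneg μ, mul_nonneg (sq_nonneg μ) (by positivity : (0:ℝ) ≤ d * (d - 1 + 1))]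
  have h3 := pow_le_pow_left₀ hpos.le hle 2
  linarith

lemma card_Icc_floor_le {a b : ℝ} (hab : a ≤ b) :
    ((Finset.Icc ⌊a⌋ ⌊b⌋).card : ℝ) ≤ b - a + 2 := by
  have h1 : ⌊a⌋ ≤ ⌊b⌋ + 1 := (Int.floor_mono hab).trans (by omega)
  have h2 : ((Finset.Icc ⌊a⌋ ⌊b⌋).card : ℤ) = ⌊b⌋ + 1 - ⌊a⌋ := by
    rw [Int.card_Icc, Int.toNat_of_nonneg (by omega)]
  have h3 : ((Finset.Icc ⌊a⌋ ⌊b⌋).card : ℝ) = ⌊b⌋ + 1 - ⌊a⌋ := by exact_mod_cast h2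
  rw [h3]
  linarith [Int.floor_le b, Int.lt_floor_add_one a]

/-- A bound for the number of lattice points in a ball. -/
lemma card_le_of_reduced {d : ℕ} (L : E d ≃ₗ[ℝ] E d) (u : OrthonormalBasis (Fin d) ℝ (E d))
    {μ : Fin d → ℝ} (hμ : ∀ l, 0 < μ l)
    (hsep : ∀ y ≠ 0, ∃ l, μ l ≤ d * |⟪u l, L (intVec y)⟫_ℝ|)
    {ρ : ℝ} (hρ : 0 ≤ ρ) (S : Finset (Fin d → ℤ)) (hS : ∀ y ∈ S, ‖L (intVec y)‖ ≤ ρ) :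
    (S.card : ℝ) ≤ ∏ l, (2 * (d * ρ / μ l) + 2) := by
  -- Round the `l`-th coordinate at scale `μ l / d`. Two points with the same rounding would differ
  -- by a vector violating `hsep`.
  let f : (Fin d → ℤ) → Fin d → ℤ := fun y l => ⌊d * ⟪u l, L (intVec y)⟫_ℝ / μ l⌋
  have hmaps : ∀ y ∈ S, f y ∈
      Fintype.piFinset fun l => Finset.Icc ⌊-(d * ρ / μ l)⌋ ⌊d * ρ / μ l⌋ := by
    intro y hy
    rw [Fintype.mem_piFinset]
    intro l
    have h1 : |⟪u l, L (intVec y)⟫_ℝ| ≤ ρ := by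
      refine (abs_real_inner_le_norm _ _).trans ?_
      rw [u.norm_eq_one, one_mul]
      exact hS y hy
    have h2 := abs_le.mp h1
    have := hμ l
    rw [Finset.mem_Icc]
    constructor
    · apply Int.floor_mono
      rw [← neg_div, ← mul_neg]
      gcongr
      exact h2.1
    · apply Int.floor_mono
      gcongr
      exact h2.2
  have hinj : Set.InjOn f S := by
    intro y _ y' _ h
    by_contra hne
    obtain ⟨l, hl⟩ := hsep (y - y') (sub_ne_zero.mpr hne)
    have h1 := Int.abs_sub_lt_one_of_floor_eq_floor (congrFun h l)
    rw [← sub_div, ← mul_sub, ← inner_sub_right, ← map_sub, ← intVec_sub, abs_div, abs_mul,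
      abs_of_pos (hμ l), div_lt_one (hμ l), Nat.abs_cast] at h1
    exact absurd hl (not_le.mpr h1)
  have hcard := Finset.card_le_card_of_injOn f hmaps hinj
  rw [Fintype.card_piFinset] at hcard
  calc (S.card : ℝ) ≤ ∏ l, ((Finset.Icc ⌊-(d * ρ / μ l)⌋ ⌊d * ρ / μ l⌋).card : ℝ) := by
        exact_mod_cast hcard
    _ ≤ ∏ l, (2 * (d * ρ / μ l) + 2) := by
        refine Finset.prod_le_prod (fun _ _ => by positivity) fun l _ => ?_
        have h0 : 0 ≤ d * ρ / μ l := by have := hμ l; positivity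
        refine (card_Icc_floor_le (by linarith)).trans (by linarith)

/-! ### Minkowski's theorem and dual vectors -/

open MeasureTheory in
/-- Minkowski's theorem for a parallelepiped given by linear inequalities. -/
lemma exists_intVec_ne_zero_abs_inner_lt {d : ℕ} (L : E d ≃ₗ[ℝ] E d)
    (u : OrthonormalBasis (Fin d) ℝ (E d)) {b : Fin d → ℝ} (hb : ∀ l, 0 < b l)
    (h : |LinearMap.det L.toLinearMap| < ∏ l, b l) :
    ∃ y ≠ 0, ∀ l, |⟪u l, L (intVec y)⟫_ℝ| < b l := by
  let B := (EuclideanSpace.basisFun (Fin d) ℝ).toBasis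
  have hdet : LinearMap.det L.toLinearMap ≠ 0 := L.isUnit_det'.ne_zero
  let T : Set (Fin d → ℝ) := Set.univ.pi fun l => Set.Ioo (-b l) (b l)
  have hT : MeasurableSet T := MeasurableSet.univ_pi fun _ => measurableSet_Ioo
  let s : Set (E d) := L.toLinearMap ⁻¹' (u.repr ⁻¹' ((WithLp.ofLp : E d → Fin d → ℝ) ⁻¹' T))
  have hmem : ∀ x, x ∈ s ↔ ∀ l, |⟪u l, L x⟫_ℝ| < b l := by
    intro x
    simp [s, T, abs_lt, OrthonormalBasis.repr_apply_apply]
  have hsymm : ∀ x ∈ s, -x ∈ s := by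
    intro x hx
    rw [hmem] at hx ⊢
    simpa using hx
  have hconv : Convex ℝ s := by
    refine Convex.linear_preimage (f := L.toLinearMap) ?_
    refine Convex.linear_preimage (f := u.repr.toLinearEquiv.toLinearMap) ?_
    refine Convex.linear_preimage (f := (WithLp.linearEquiv 2 ℝ (Fin d → ℝ)).toLinearMap) ?_
    exact convex_pi fun _ _ => convex_Ioo _ _
  have hfd : volume (ZSpan.fundamentalDomain B) = 1 := by
    rw [measure_congr (ZSpan.fundamentalDomain_ae_parallelepiped B volume)]
    simpa [B] using (EuclideanSpace.basisFun (Fin d) ℝ).volume_parallelepiped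
  have hTvol : volume T = ENNReal.ofReal (∏ l, (2 * b l)) := by
    rw [Real.volume_pi_Ioo, ENNReal.ofReal_prod_of_nonneg fun l _ => by have := hb l; positivity]
    refine Finset.prod_congr rfl fun l _ => ?_
    congr 1
    ring
  have hvol : volume s =
      ENNReal.ofReal |(LinearMap.det L.toLinearMap)⁻¹| * ENNReal.ofReal (∏ l, (2 * b l)) := by
    rw [Measure.addHaar_preimage_linearMap volume hdet,
      u.measurePreserving_repr.measure_preimage
        ((PiLp.volume_preserving_ofLp (Fin d)).measurable hT).nullMeasurableSet,
      (PiLp.volume_preserving_ofLp (Fin d)).measure_preimage hT.nullMeasurableSet, hTvol]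
  have hlt : volume (ZSpan.fundamentalDomain B) * 2 ^ Module.finrank ℝ (E d) < volume s := by
    rw [hvol, hfd, one_mul, ← ENNReal.ofReal_mul (abs_nonneg _), finrank_euclideanSpace_fin,
      Finset.prod_mul_distrib, Finset.prod_const, Finset.card_univ, Fintype.card_fin, abs_inv]
    rw [show (2 : ENNReal) ^ d = ENNReal.ofReal (2 ^ d) by
      rw [ENNReal.ofReal_pow (by norm_num)]; simp]
    rw [ENNReal.ofReal_lt_ofReal_iff_of_nonneg (by positivity), inv_mul_eq_div,
      lt_div_iff₀ (abs_pos.mpr hdet)]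
    gcongr
  have : Countable (Submodule.span ℤ (Set.range B)).toAddSubgroup :=
    inferInstanceAs (Countable (Submodule.span ℤ (Set.range B)))
  obtain ⟨x, hx0, hxs⟩ := exists_ne_zero_mem_lattice_of_measure_mul_two_pow_lt_measure
    (L := (Submodule.span ℤ (Set.range B)).toAddSubgroup)
    (ZSpan.isAddFundamentalDomain B volume) hsymm hconv hlt
  have hxB := (B.mem_span_iff_repr_mem ℤ (x : E d)).mp x.2
  choose y hy using hxB
  have hyx : intVec y = x := by
    ext i
    simpa [B] using hy i
  refine ⟨y, ?_, ?_⟩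
  · rintro rfl
    rw [intVec_zero] at hyx
    exact hx0 (Subtype.ext hyx.symm)
  · rw [hyx, ← hmem]
    exact hxs

/-- An integer vector almost orthogonal to all but the last of the reduced vectors. -/
lemma exists_dual_vector {n : ℕ} (L : E (n + 1) ≃ₗ[ℝ] E (n + 1))
    {z : Fin (n + 1) → Fin (n + 1) → ℤ} (hz : LinearIndependent ℝ fun i => intVec (z i)) :
    ∃ w ≠ 0, ∀ v, |⟪intVec w, v⟫_ℝ| * |LinearMap.det L.toLinearMap| ≤
      (∏ i : Fin n, ‖L (intVec (z i.castSucc))‖) * ‖L v‖ := by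
  let w : Fin (n + 1) → ℤ := fun i => (Matrix.of z).adjugate i (Fin.last n)
  have hw : ∀ v : E (n + 1), ⟪intVec w, v⟫_ℝ =
      vdet (Function.update (fun i => intVec (z i)) (Fin.last n) v) := by
    intro v
    have h1 : (Matrix.of fun i j => (Function.update (fun i => intVec (z i)) (Fin.last n) v) i j) =
        ((Matrix.of z).map (Int.cast : ℤ → ℝ)).updateRow (Fin.last n) v := by
      ext i j
      by_cases h : i = Fin.last n
      · subst h; simp
      · simp [h, Matrix.updateRow_ne]
    rw [vdet, h1, ← Matrix.cramer_transpose_apply, Matrix.cramer_eq_adjugate_mulVec,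
      Matrix.mulVec, dotProduct, PiLp.inner_apply]
    refine Finset.sum_congr rfl fun i _ => ?_
    have h2 : ((Matrix.of z).map (Int.cast : ℤ → ℝ)).adjugate =
        (Matrix.of z).adjugate.map (Int.cast : ℤ → ℝ) :=
      ((Int.castRingHom ℝ).map_adjugate (Matrix.of z)).symm
    rw [← Matrix.adjugate_transpose, Matrix.transpose_apply, h2]
    simp [w, mul_comm]
  refine ⟨w, ?_, fun v => ?_⟩
  · rintro h0
    have h1 := hw (intVec (z (Fin.last n)))
    have h2 := one_le_abs_vdet_intVec hz
    rw [Function.update_eq_self, h0, intVec_zero, inner_zero_left] at h1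
    rw [← h1] at h2
    norm_num at h2
  · rw [hw v, mul_comm, ← abs_mul, ← vdet_map]
    refine (abs_vdet_le _).trans_eq ?_
    rw [Fin.prod_univ_castSucc]
    congr 1
    · refine Finset.prod_congr rfl fun i _ => ?_
      simp
    · simp

lemma le_div_mul_of_mul_le {a D P x m c : ℝ} (hD : 0 < D) (hm : 0 < m) (hx : 0 ≤ x)
    (h1 : a * D ≤ P * x) (h2 : P * m ≤ c * D) : a ≤ c / m * x := by
  rw [div_mul_eq_mul_div, le_div_iff₀ hm]
  refine le_of_mul_le_mul_right ?_ hD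
  nlinarith [mul_le_mul_of_nonneg_right h1 hm.le, mul_le_mul_of_nonneg_right h2 hx]

/-- The facts from the geometry of numbers used below: sizes `μ` of a reduced basis of the lattice
`L ℤ^d`, the number of lattice points in balls, and a short dual vector. -/
lemma exists_lattice_data {d : ℕ} (hd : 0 < d) (L : E d ≃ₗ[ℝ] E d) :
    ∃ (μ : Fin d → ℝ) (m : ℝ) (w : Fin d → ℤ),
      (∀ i, 0 < μ i) ∧ (∀ i, ∃ z ≠ 0, μ i = ‖L (intVec z)‖) ∧ (∀ i, μ i ≤ m) ∧ 0 < m ∧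
      |LinearMap.det L.toLinearMap| ≤ ∏ i, μ i ∧
      (∀ (ρ : ℝ), 0 ≤ ρ → ∀ S : Finset (Fin d → ℤ), (∀ y ∈ S, ‖L (intVec y)‖ ≤ ρ) →
        (S.card : ℝ) ≤ ∏ l, (2 * (d * ρ / μ l) + 2)) ∧
      w ≠ 0 ∧ ∀ v, |⟪intVec w, v⟫_ℝ| ≤ (d : ℝ) ^ d / m * ‖L v‖ := by
  obtain ⟨n, rfl⟩ : ∃ n, d = n + 1 := ⟨d - 1, by omega⟩
  obtain ⟨z, u, hz, hmono, hsep⟩ := exists_reduced L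
  obtain ⟨w, hw0, hw⟩ := exists_dual_vector L hz
  have hz0 : ∀ i, z i ≠ 0 := by
    intro i h
    apply hz.ne_zero i
    simp [h]
  have hpos : ∀ i, 0 < ‖L (intVec (z i))‖ := by
    intro i
    rw [norm_pos_iff, Ne, LinearEquiv.map_eq_zero_iff]
    exact hz.ne_zero i
  have hdet : 0 < |LinearMap.det L.toLinearMap| := abs_pos.mpr L.isUnit_det'.ne_zero
  refine ⟨fun i => ‖L (intVec (z i))‖, ‖L (intVec (z (Fin.last n)))‖, w, hpos,
    fun i => ⟨z i, hz0 i, rfl⟩, fun i => hmono (Fin.le_last i), hpos _, ?_,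
    fun ρ hρ S hS => card_le_of_reduced L u hpos hsep hρ S hS, hw0, fun v => ?_⟩
  · have h1 := abs_vdet_le fun i => L.toLinearMap (intVec (z i))
    rw [vdet_map, abs_mul] at h1
    refine le_trans ?_ h1
    exact le_mul_of_one_le_right hdet.le (one_le_abs_vdet_intVec hz)
  -- The upper half of Minkowski's second theorem: otherwise the box with half-sides equal to the
  -- sizes divided by `n + 1` would contain a nonzero lattice point, against `hsep`.
  · have hmink : ∏ i, ‖L (intVec (z i))‖ ≤
        ((n + 1 : ℕ) : ℝ) ^ (n + 1) * |LinearMap.det L.toLinearMap| := by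
      by_contra! hlt
      obtain ⟨y, hy0, hy⟩ := exists_intVec_ne_zero_abs_inner_lt L u
        (b := fun l => ‖L (intVec (z l))‖ / ((n + 1 : ℕ) : ℝ))
        (fun l => div_pos (hpos l) (by positivity)) (by
          rw [Finset.prod_div_distrib, Finset.prod_const, Finset.card_univ, Fintype.card_fin,
            lt_div_iff₀ (by positivity), mul_comm]
          exact hlt)
      obtain ⟨l, hl⟩ := hsep y hy0
      have := hy l
      rw [lt_div_iff₀ (by positivity), mul_comm] at this
      linarith
    rw [Fin.prod_univ_castSucc] at hmink
    have hm := hpos (Fin.last n)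
    exact le_div_mul_of_mul_le hdet hm (norm_nonneg _) (hw v) hmink

/-! ### Euclidean coordinates for the form, and flattening a box -/

/-- Diagonalize the form. Positive definiteness makes all weights positive, so their square roots
can be absorbed into the coordinates. -/
lemma exists_norm_sq_eq {d : ℕ} (Q : QuadraticForm ℝ (E d)) (hQ : Q.PosDef) :
    ∃ A : E d ≃ₗ[ℝ] E d, ∀ x, Q x = ‖A x‖ ^ 2 := by
  obtain ⟨w, -, ⟨f⟩⟩ := Q.equivalent_one_neg_one_weighted_sum_squared
    (QuadraticMap.separatingLeft_of_anisotropic _ hQ.anisotropic)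
  have hw : ∀ i, 0 < w i := by
    intro i
    have h1 : f.symm (Pi.single i 1) ≠ 0 := by
      intro h
      have := congrArg f h
      simp at this
    have h2 := hQ _ h1
    rw [f.symm.map_app, QuadraticMap.weightedSumSquares_apply] at h2
    simpa [Pi.single_apply] using h2
  let g : (Fin (Module.finrank ℝ (E d)) → ℝ) ≃ₗ[ℝ] (Fin (Module.finrank ℝ (E d)) → ℝ) :=
    LinearEquiv.piCongrRight fun i => LinearEquiv.smulOfNeZero ℝ ℝ (√(w i))
      (Real.sqrt_pos.mpr (hw i)).ne'
  let r := finCongr (finrank_euclideanSpace_fin (𝕜 := ℝ) (n := d)).symm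
  refine ⟨f.toLinearEquiv ≪≫ₗ g ≪≫ₗ LinearEquiv.funCongrLeft ℝ ℝ r ≪≫ₗ
    (WithLp.linearEquiv 2 ℝ (Fin d → ℝ)).symm, fun x => ?_⟩
  rw [← f.map_app, QuadraticMap.weightedSumSquares_apply, EuclideanSpace.norm_sq_eq,
    ← r.sum_comp]
  refine Finset.sum_congr rfl fun i _ => ?_
  have h := Real.mul_self_sqrt (hw (r i)).le
  rw [Real.norm_eq_abs, sq_abs]
  change _ = (√(w (r i)) * f x (r i)) ^ 2
  rw [mul_pow, sq, h, sq]
  rfl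

lemma exists_norm_equivalence {d : ℕ} (A : E d ≃ₗ[ℝ] E d) :
    ∃ a : ℝ, 1 ≤ a ∧ (∀ v, ‖A v‖ ≤ a * ‖v‖) ∧ ∀ v, ‖v‖ ≤ a * ‖A v‖ := by
  let B := A.toContinuousLinearEquiv
  refine ⟨max 1 (max ‖(B : E d →L[ℝ] E d)‖ ‖(B.symm : E d →L[ℝ] E d)‖), le_max_left _ _,
    fun v => ?_, fun v => ?_⟩
  · refine ((B : E d →L[ℝ] E d).le_opNorm v).trans ?_
    gcongr
    exact (le_max_left _ _).trans (le_max_right _ _)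
  · have := (B.symm : E d →L[ℝ] E d).le_opNorm (A v)
    have h : (B.symm : E d →L[ℝ] E d) (A v) = v := B.symm_apply_apply v
    rw [h] at this
    refine this.trans ?_
    gcongr
    exact (le_max_right _ _).trans (le_max_right _ _)

/-- The linear change of variables that turns a flat box orthogonal to `e` into a ball. -/
lemma exists_flattening {d : ℕ} (A : E d ≃ₗ[ℝ] E d) {R del : ℝ} (hR : 0 < R) (hdel : 0 < del)
    (e : E d) :
    ∃ L : E d ≃ₗ[ℝ] E d, (∀ v, L v = R⁻¹ • A v + (del⁻¹ * ⟪e, A v⟫_ℝ) • e) ∧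
      LinearMap.det L.toLinearMap =
        R⁻¹ ^ d * (1 + R / del * ‖e‖ ^ 2) * LinearMap.det A.toLinearMap := by
  -- The transvection `v ↦ v + f v • e` stretches only along `e`, by the factor `1 + R / del * ‖e‖ ^
  -- 2`; this gives the determinant.
  let f : Module.Dual ℝ (E d) := (R / del) • (innerₛₗ ℝ e)
  let G : E d →ₗ[ℝ] E d := (R⁻¹ • LinearMap.transvection f e) ∘ₗ A.toLinearMap
  have hG : LinearMap.det G = R⁻¹ ^ d * (1 + R / del * ‖e‖ ^ 2) * LinearMap.det A.toLinearMap := by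
    rw [LinearMap.det_comp, LinearMap.det_smul, LinearMap.transvection.det]
    simp [f]
  have hG0 : IsUnit (LinearMap.det G) := by
    rw [isUnit_iff_ne_zero, hG]
    have := A.isUnit_det'.ne_zero
    positivity
  refine ⟨LinearEquiv.ofBijective G ((Module.End.isUnit_iff G).mp
    ((LinearMap.isUnit_iff_isUnit_det G).mpr hG0)), fun v => ?_, ?_⟩
  · simp only [LinearEquiv.ofBijective_apply, G, LinearMap.comp_apply, LinearMap.smul_apply,
      LinearMap.transvection.apply, LinearEquiv.coe_coe, smul_add, smul_smul, f, innerₛₗ_apply_apply,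
      smul_eq_mul]
    congr 2
    field_simp
  · rw [← hG]
    congr 1

/-! ### Many points force a short dual vector -/

/-- If more than `k` sizes exceeded 1, at most `d - 1 - k` factors of the count would be nontrivial,
each at most a multiple of `R`, contradicting `hTR`. With at most `k` large sizes, `∏ max 1 (1 / μ
i) ≤ (max 1 m) ^ k / ∏ μ i`, and `hprod` bounds `T`. -/
lemma le_mul_pow_of_prod_bounds {d k : ℕ} (hkd : k + 1 ≤ d)
    {μ : Fin d → ℝ} {m a R del Δ C T K N : ℝ} (hμ : ∀ i, 0 < μ i) (hm : ∀ i, μ i ≤ m)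
    (ha : 1 ≤ a) (hR : 1 ≤ R) (hdel : 0 < del) (hΔ : 0 < Δ) (hC : 1 ≤ C)
    (hlow : ∀ i, 1 ≤ a * R * μ i) (hprod : Δ ≤ R ^ (d - 1) * del * ∏ i, μ i)
    (hN : N ≤ ∏ i, (C * max 1 (1 / μ i))) (hTN : R ^ (d - 1) * del * T < 2 * N)
    (hK1 : 2 * C ^ d / Δ ≤ K) (hK2 : 2 * C ^ d * a ^ d ≤ K) (hT : K < T)
    (hTR : K < R ^ k * del * T) : T ≤ 2 * C ^ d / Δ * m ^ k := by
  set H := Finset.univ.filter fun i => 1 < μ i with hH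
  have hP : 0 < ∏ i, μ i := Finset.prod_pos fun i _ => hμ i
  have hC0 : 0 < C := by linarith
  have hR0 : 0 < R := by linarith
  rw [Finset.prod_mul_distrib, Finset.prod_const, Finset.card_univ, Fintype.card_fin] at hN
  have hcard : H.card ≤ k := by
    by_contra! hlt
    have h1 : ∏ i, max 1 (1 / μ i) ≤ (a * R) ^ (d - 1 - k) := by
      have h2 : ∀ i ∈ Finset.univ, max 1 (1 / μ i) ≤ if 1 < μ i then 1 else a * R := by
        intro i _
        split_ifs with h
        · refine max_le le_rfl ?_
          rw [div_le_one (hμ i)]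
          exact h.le
        · refine max_le (one_le_mul_of_one_le_of_one_le ha hR) ?_
          rw [div_le_iff₀ (hμ i)]
          exact hlow i
      refine (Finset.prod_le_prod (fun i _ => by positivity) h2).trans ?_
      rw [Finset.prod_ite, Finset.prod_const_one, one_mul, Finset.prod_const]
      refine pow_le_pow_right₀ (one_le_mul_of_one_le_of_one_le ha hR) ?_
      have : H.card + _ = _ := Finset.card_filter_add_card_filter_not
        (s := (Finset.univ : Finset (Fin d))) (fun i => 1 < μ i)
      rw [Finset.card_univ, Fintype.card_fin] at this
      omega
    have h3 : (a * R) ^ (d - 1 - k) ≤ a ^ d * R ^ (d - 1 - k) := by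
      rw [mul_pow]
      gcongr
      · omega
    have h4 : R ^ (d - 1) = R ^ (d - 1 - k) * R ^ k := by
      rw [← pow_add]
      congr 1
      omega
    have h5 : N ≤ C ^ d * (a ^ d * R ^ (d - 1 - k)) := hN.trans (by gcongr; exact h1.trans h3)
    have h6 : R ^ (d - 1) * del * T = R ^ (d - 1 - k) * (R ^ k * del * T) := by rw [h4]; ring
    have h7 : R ^ (d - 1 - k) * K ≤ R ^ (d - 1) * del * T := by rw [h6]; gcongr
    have h8 : R ^ (d - 1 - k) * (2 * C ^ d * a ^ d) ≤ R ^ (d - 1 - k) * K := by gcongr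
    linarith
  have h1 : ∏ i, max 1 (1 / μ i) ≤ (max 1 m) ^ k / ∏ i, μ i := by
    have h2 : ∀ i ∈ Finset.univ, max 1 (1 / μ i) ≤ (if 1 < μ i then max 1 m else 1) / μ i := by
      intro i _
      have := hμ i
      rw [le_div_iff₀ this, max_mul_of_nonneg _ _ this.le, one_mul, div_mul_cancel₀ _ this.ne']
      split_ifs with h
      · exact max_le ((hm i).trans (le_max_right _ _)) (le_max_left _ _)
      · exact max_le (not_lt.mp h) le_rfl
    refine (Finset.prod_le_prod (fun i _ => by positivity) h2).trans ?_
    rw [Finset.prod_div_distrib]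
    gcongr
    rw [Finset.prod_ite, Finset.prod_const_one, mul_one, Finset.prod_const]
    exact pow_le_pow_right₀ (le_max_left _ _) hcard
  have h2 : T < 2 * C ^ d / Δ * (max 1 m) ^ k := by
    have h3 : N ≤ C ^ d * ((max 1 m) ^ k / ∏ i, μ i) := hN.trans (by gcongr)
    rw [← mul_div_assoc, le_div_iff₀ hP] at h3
    have hV : 0 < R ^ (d - 1) * del := by positivity
    have hT0 : 0 < T := lt_of_le_of_lt (le_trans (by positivity) hK1) hT
    rw [div_mul_eq_mul_div, lt_div_iff₀ hΔ]
    calc T * Δ ≤ T * (R ^ (d - 1) * del * ∏ i, μ i) := by gcongr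
      _ = R ^ (d - 1) * del * T * ∏ i, μ i := by ring
      _ < 2 * N * ∏ i, μ i := by gcongr
      _ ≤ _ := by linarith
  -- The case `m ≤ 1` would give `T < 2 * C ^ d / Δ ≤ K`, against `hT`.
  rcases le_total m 1 with h | h
  · rw [max_eq_left h] at h2
    simp only [one_pow, mul_one] at h2
    linarith
  · rw [max_eq_right h] at h2
    exact h2.le

/-- Many integer points in a flat box orthogonal to `e` force a short dual vector. -/
lemma exists_dual_vector_of_many_points {d : ℕ} (hd : 0 < d) (A : E d ≃ₗ[ℝ] E d) (b : ℝ)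
    (hb : 0 ≤ b) :
    ∃ K C : ℝ, 0 < K ∧ 0 < C ∧ ∀ (R del : ℝ) (e : E d), 1 ≤ R → 0 < del →
      1 / 2 ≤ ‖e‖ → ‖e‖ ≤ 2 → ∀ S : Finset (Fin d → ℤ),
      (∀ y ∈ S, ‖A (intVec y)‖ ≤ b * R ∧ |⟪e, A (intVec y)⟫_ℝ| ≤ b * del) →
      ∀ (k : ℕ) (T : ℝ), 1 ≤ k → k + 1 ≤ d → K < T → K < R ^ k * del * T →
      R ^ (d - 1) * del * T < 2 * S.card →
      ∃ w : Fin d → ℤ, w ≠ 0 ∧ ∀ v, |⟪intVec w, v⟫_ℝ| ≤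
        C / T ^ (1 / (k : ℝ)) * (‖A v‖ / R + 2 * |⟪e, A v⟫_ℝ| / del) := by
  obtain ⟨a, ha, -, haA⟩ := exists_norm_equivalence A
  set D := |LinearMap.det A.toLinearMap| with hD
  have hD0 : 0 < D := abs_pos.mpr A.isUnit_det'.ne_zero
  -- The flattened points lie in the ball of radius `3 * b`: `b` from the wide directions and `2 *
  -- b` from the thin one, since `‖e‖ ≤ 2`.
  set C1 : ℝ := 2 * (d * (3 * b)) + 2 with hC1
  have hC1' : 1 ≤ C1 := by
    have : 0 ≤ d * (3 * b) := by positivity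
    linarith
  set C2 := 2 * C1 ^ d / (D / 4) with hC2
  have hC20 : 0 < C2 := by positivity
  refine ⟨max C2 (2 * C1 ^ d * a ^ d), (d : ℝ) ^ d * max 1 C2, lt_max_of_lt_left hC20,
    by positivity, ?_⟩
  intro R del e hR hdel he1 he2 S hS k T hk hkd hT hTR hcard
  have hR0 : 0 < R := by linarith
  have hT0 : 0 < T := (lt_max_of_lt_left hC20).trans hT
  obtain ⟨L, hL, hLdet⟩ := exists_flattening A hR0 hdel e
  obtain ⟨μ, m, w, hμ, hμz, hμm, hm, hdetμ, hcount, hw0, hw⟩ := exists_lattice_data hd L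
  have hLle : ∀ v, ‖L v‖ ≤ ‖A v‖ / R + 2 * |⟪e, A v⟫_ℝ| / del := by
    intro v
    rw [hL]
    refine (norm_add_le _ _).trans ?_
    rw [norm_smul, norm_smul, Real.norm_eq_abs, Real.norm_eq_abs, abs_mul, abs_inv, abs_inv,
      abs_of_pos hR0, abs_of_pos hdel]
    have h1 : del⁻¹ * |⟪e, A v⟫_ℝ| * ‖e‖ ≤ del⁻¹ * |⟪e, A v⟫_ℝ| * 2 := by gcongr
    have h2 : R⁻¹ * ‖A v‖ = ‖A v‖ / R := by ring
    have h3 : del⁻¹ * |⟪e, A v⟫_ℝ| * 2 = 2 * |⟪e, A v⟫_ℝ| / del := by ring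
    linarith
  have hLge : ∀ v, ‖A v‖ / R ≤ ‖L v‖ := by
    intro v
    refine le_of_sq_le_sq ?_ (norm_nonneg _)
    rw [hL, norm_add_sq_real, norm_smul, norm_smul, Real.norm_eq_abs, Real.norm_eq_abs, mul_pow,
      mul_pow, sq_abs, sq_abs, inner_smul_left, inner_smul_right, real_inner_comm e (A v)]
    simp only [conj_trivial]
    have h1 : 0 ≤ 2 * (R⁻¹ * (del⁻¹ * ⟪e, A v⟫_ℝ * ⟪e, A v⟫_ℝ)) := by
      have := mul_self_nonneg ⟪e, A v⟫_ℝ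
      rw [mul_assoc]
      positivity
    have h2 : 0 ≤ (del⁻¹ * ⟪e, A v⟫_ℝ) ^ 2 * ‖e‖ ^ 2 := by positivity
    have h3 : (‖A v‖ / R) ^ 2 = R⁻¹ ^ 2 * ‖A v‖ ^ 2 := by ring
    linarith
  have hlow : ∀ i, 1 ≤ a * R * μ i := by
    intro i
    obtain ⟨z, hz, hzi⟩ := hμz i
    have h1 := (one_le_norm_intVec hz).trans (haA (intVec z))
    have h2 := hLge (intVec z)
    rw [← hzi, div_le_iff₀ hR0] at h2
    have h3 := mul_le_mul_of_nonneg_left h2 (by linarith : (0 : ℝ) ≤ a)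
    linarith
  -- The determinant of `L` times `R ^ (d - 1) * del` is `(del / R + ‖e‖ ^ 2) * D` in absolute
  -- value, and `‖e‖ ≥ 1 / 2`.
  have hprod : D / 4 ≤ R ^ (d - 1) * del * ∏ i, μ i := by
    refine le_trans ?_ (mul_le_mul_of_nonneg_left hdetμ (by positivity))
    have hpos : 0 < R⁻¹ ^ d * (1 + R / del * ‖e‖ ^ 2) := by positivity
    rw [hLdet, abs_mul, abs_of_pos hpos, ← hD]
    obtain ⟨n, rfl⟩ : ∃ n, d = n + 1 := ⟨d - 1, by omega⟩
    have h1 : R ^ (n + 1 - 1) * del * (R⁻¹ ^ (n + 1) * (1 + R / del * ‖e‖ ^ 2) * D) =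
        (del / R + ‖e‖ ^ 2) * D := by
      simp only [Nat.add_sub_cancel]
      rw [inv_pow, pow_succ]
      field_simp
    rw [h1]
    have h2 : (1 / 2 : ℝ) ^ 2 ≤ ‖e‖ ^ 2 := by gcongr
    have h3 : 0 < del / R := by positivity
    have h4 : (1 / 4 : ℝ) * D ≤ (del / R + ‖e‖ ^ 2) * D := by gcongr; linarith
    linarith
  have hN : (S.card : ℝ) ≤ ∏ i, (C1 * max 1 (1 / μ i)) := by
    refine (hcount (3 * b) (by positivity) S fun y hy => ?_).trans ?_
    · obtain ⟨h1, h2⟩ := hS y hy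
      refine (hLle _).trans ?_
      have h3 : ‖A (intVec y)‖ / R ≤ b := by rwa [div_le_iff₀ hR0]
      have h4 : 2 * |⟪e, A (intVec y)⟫_ℝ| / del ≤ 2 * b := by
        rw [div_le_iff₀ hdel]; linarith
      linarith
    · refine Finset.prod_le_prod (fun i _ => by have := hμ i; positivity) fun i _ => ?_
      have h1 : 0 ≤ d * (3 * b) := by positivity
      have h2 : d * (3 * b) / μ i ≤ d * (3 * b) * max 1 (1 / μ i) := by
        rw [div_eq_mul_one_div]
        gcongr
        exact le_max_right _ _
      have h3 : 1 ≤ max 1 (1 / μ i) := le_max_left _ _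
      rw [hC1]
      linarith
  have hTm := le_mul_pow_of_prod_bounds hkd hμ hμm ha hR hdel (by positivity) hC1' hlow hprod hN
    hcard (le_max_left C2 _) (le_max_right C2 _) hT hTR
  refine ⟨w, hw0, fun v => (hw v).trans ?_⟩
  have hk0 : (k : ℝ) ≠ 0 := by positivity
  have h1 : T ^ (1 / (k : ℝ)) ≤ max 1 C2 * m := by
    have h2 : T ≤ (max 1 C2 * m) ^ k := by
      rw [mul_pow]
      refine hTm.trans ?_
      gcongr
      exact (le_max_right 1 C2).trans (le_self_pow₀ (le_max_left _ _) (by omega))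
    calc T ^ (1 / (k : ℝ)) ≤ ((max 1 C2 * m) ^ k) ^ (1 / (k : ℝ)) :=
          Real.rpow_le_rpow hT0.le h2 (by positivity)
      _ = max 1 C2 * m := by
          rw [one_div, Real.pow_rpow_inv_natCast (by positivity) (by omega)]
  have h3 : 0 < T ^ (1 / (k : ℝ)) := Real.rpow_pos_of_pos hT0 _
  have h4 : (d : ℝ) ^ d / m ≤ (d : ℝ) ^ d * max 1 C2 / T ^ (1 / (k : ℝ)) := by
    rw [div_le_div_iff₀ hm h3, mul_assoc]
    gcongr
  gcongr
  exact hLle v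

/-! ### Covering the shell by cells and counting caps -/

lemma norm_le_sum_abs {d : ℕ} (x : E d) : ‖x‖ ≤ ∑ i, |x i| := by
  conv_lhs => rw [← (EuclideanSpace.basisFun (Fin d) ℝ).sum_repr x]
  refine (norm_sum_le _ _).trans (Finset.sum_le_sum fun i _ => ?_)
  simp [norm_smul]

lemma exists_norm_le_mul_abs {d : ℕ} (hd : 0 < d) (x : E d) : ∃ i, ‖x‖ ≤ d * |x i| := by
  have : Nonempty (Fin d) := ⟨⟨0, hd⟩⟩
  obtain ⟨i, -, hi⟩ := Finset.exists_max_image Finset.univ (fun i => |x i|) Finset.univ_nonempty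
  refine ⟨i, (norm_le_sum_abs x).trans ?_⟩
  simpa using Finset.sum_le_card_nsmul Finset.univ (fun i => |x i|) |x i| hi

/-- Near a thin spherical shell a point is determined up to a small error by a large coordinate's
index and sign together with the approximate values of the other coordinates. -/
lemma norm_sub_lt_of_coords {d : ℕ} {x y : E d} {lam del R η : ℝ}
    (hlam : 2 ≤ lam) (hdel : del < 1) (hR : 0 < R) (hη : 0 < η) (hR2 : R ^ 2 = lam * del)
    (hRlam : R ≤ η * lam) (hx : |‖x‖ - lam| < del) (hy : |‖y‖ - lam| < del) {i : Fin d}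
    (hxi : ‖x‖ ≤ d * |x i|) (hyi : ‖y‖ ≤ d * |y i|) (hsign : 0 ≤ x i ↔ 0 ≤ y i)
    (hl : ∀ l ≠ i, |x l - y l| < η * R) : ‖x - y‖ ≤ d * (8 * d + 4 * d ^ 2) * η * R := by
  have hd : (1 : ℝ) ≤ d := by exact_mod_cast i.pos
  have hdel0 : 0 < del := (abs_nonneg _).trans_lt hx
  rw [abs_lt] at hx hy
  have hx2 : ‖x‖ ≤ 2 * lam := by linarith
  have hy2 : ‖y‖ ≤ 2 * lam := by linarith
  have hηR : 0 < η * R := by positivity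
  have hlam0 : 0 < lam := by linarith
  have hnorm : |‖x‖ ^ 2 - ‖y‖ ^ 2| ≤ 8 * (η * R * lam) := by
    have h1 : |‖x‖ - ‖y‖| ≤ 2 * del := by rw [abs_le]; constructor <;> linarith
    have h2 : |‖x‖ + ‖y‖| ≤ 4 * lam := by
      rw [abs_of_nonneg (by positivity)]; linarith
    rw [show ‖x‖ ^ 2 - ‖y‖ ^ 2 = (‖x‖ - ‖y‖) * (‖x‖ + ‖y‖) by ring, abs_mul]
    calc _ ≤ 2 * del * (4 * lam) := by gcongr
      _ = 8 * (R * R) := by linarith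
      _ ≤ 8 * (R * (η * lam)) := by gcongr
      _ = _ := by ring
  have hother : ∀ l ≠ i, |x l ^ 2 - y l ^ 2| ≤ 4 * (η * R * lam) := by
    intro l hli
    have h2 : |x l + y l| ≤ 4 * lam := by
      refine (abs_add_le _ _).trans ?_
      linarith [abs_coord_le_norm x l, abs_coord_le_norm y l]
    rw [show x l ^ 2 - y l ^ 2 = (x l - y l) * (x l + y l) by ring, abs_mul]
    calc _ ≤ η * R * (4 * lam) := by
          have := (hl l hli).le
          gcongr
      _ = _ := by ring
  have hsq : |x i ^ 2 - y i ^ 2| ≤ (8 + 4 * d) * (η * R * lam) := by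
    have h1 : x i ^ 2 - y i ^ 2 =
        (‖x‖ ^ 2 - ‖y‖ ^ 2) - ∑ l ∈ Finset.univ.erase i, (x l ^ 2 - y l ^ 2) := by
      rw [EuclideanSpace.norm_sq_eq, EuclideanSpace.norm_sq_eq, ← Finset.sum_sub_distrib,
        ← Finset.add_sum_erase _ _ (Finset.mem_univ i)]
      simp
    have h2 : |∑ l ∈ Finset.univ.erase i, (x l ^ 2 - y l ^ 2)| ≤ d * (4 * (η * R * lam)) := by
      refine (Finset.abs_sum_le_sum_abs _ _).trans ?_
      refine (Finset.sum_le_card_nsmul _ _ _ fun l hl' =>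
        hother l (Finset.ne_of_mem_erase hl')).trans ?_
      rw [nsmul_eq_mul]
      gcongr
      exact (Finset.card_le_univ _).trans_eq (by simp)
    rw [h1]
    refine (abs_sub _ _).trans ?_
    linarith
  -- Equal signs prevent cancellation, so the bound for `x i ^ 2 - y i ^ 2` can be divided by `x i +
  -- y i`.
  have hsum : lam / d ≤ |x i + y i| := by
    have h1 : |x i + y i| = |x i| + |y i| := by
      by_cases h : 0 ≤ x i
      · have h' := hsign.mp h
        rw [abs_of_nonneg h, abs_of_nonneg h', abs_of_nonneg (by linarith)]
      · have h' : ¬ 0 ≤ y i := fun h' => h (hsign.mpr h')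
        push Not at h h'
        rw [abs_of_neg h, abs_of_neg h', abs_of_neg (by linarith)]
        ring
    rw [h1, div_le_iff₀ (by positivity)]
    linarith
  have hi : |x i - y i| ≤ (8 * d + 4 * d ^ 2) * (η * R) := by
    have h1 : |x i - y i| * (lam / d) ≤ (8 + 4 * d) * (η * R * lam) := by
      refine le_trans ?_ hsq
      rw [show x i ^ 2 - y i ^ 2 = (x i - y i) * (x i + y i) by ring, abs_mul]
      gcongr
    rw [mul_div_assoc', div_le_iff₀ (by positivity)] at h1
    refine le_of_mul_le_mul_right ?_ hlam0
    linarith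
  refine (norm_le_sum_abs _).trans ?_
  refine (Finset.sum_le_card_nsmul _ _ ((8 * d + 4 * d ^ 2) * (η * R)) fun l _ => ?_).trans ?_
  · by_cases h : l = i
    · rw [h]; exact hi
    · refine (hl l h).le.trans ?_
      refine le_mul_of_one_le_left hηR.le ?_
      nlinarith
  · rw [nsmul_eq_mul, Finset.card_univ, Fintype.card_fin]
    apply le_of_eq
    ring

/-- A piece of diameter `ρ` of a thin spherical shell is covered by `≪ (ρ / R) ^ (d - 1)` cells of
diameter less than `ε R`. -/
lemma exists_cell_cover {d : ℕ} (hd : 0 < d) {ε : ℝ} (hε : 0 < ε) :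
    ∃ lam₀ C : ℝ, 2 ≤ lam₀ ∧ 0 < C ∧ ∀ lam del : ℝ, lam₀ ≤ lam → 0 < del → del < 1 →
      ∀ (y₀ : E d) (ρ : ℝ), √(lam * del) ≤ ρ →
      ∃ (F : Finset (Σ _ : Fin d × Prop, Fin d → ℤ)) (κ : E d → Σ _ : Fin d × Prop, Fin d → ℤ),
        (F.card : ℝ) ≤ C * (ρ / √(lam * del)) ^ (d - 1) ∧
        (∀ y, ‖y - y₀‖ ≤ ρ → κ y ∈ F) ∧
        ∀ x y, |‖x‖ - lam| < del → |‖y‖ - lam| < del → κ x = κ y →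
          ‖x - y‖ < ε * √(lam * del) := by
  classical
  set D : ℝ := d * (8 * d + 4 * d ^ 2) with hD
  set η := ε / (D + 1) with hη
  have hη0 : 0 < η := by positivity
  -- The threshold `1 / η ^ 2` ensures `R ≤ η * lam`, since `R ^ 2 < lam`. The factor `2 * d` counts
  -- signs and dominant coordinates.
  refine ⟨max 2 (1 / η ^ 2), 2 * d * (2 / η + 2) ^ (d - 1), le_max_left _ _, by positivity, ?_⟩
  intro lam del hlam hdel hdel1 y₀ ρ hρ
  have hlam2 : 2 ≤ lam := (le_max_left _ _).trans hlam
  have hlamη : 1 / η ^ 2 ≤ lam := (le_max_right _ _).trans hlam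
  have hlam0 : 0 < lam := by linarith
  set R := √(lam * del) with hR
  have hR0 : 0 < R := Real.sqrt_pos.mpr (by positivity)
  have hR2 : R ^ 2 = lam * del := Real.sq_sqrt (by positivity)
  have hRlam : R ≤ η * lam := by
    refine le_of_sq_le_sq ?_ (by positivity)
    rw [hR2]
    rw [div_le_iff₀ (by positivity)] at hlamη
    nlinarith
  choose i hi using exists_norm_le_mul_abs (d := d) hd
  -- A cell records a dominant coordinate, its sign, and the other coordinates rounded at scale `η *
  -- R`. The dominant entry is set to 0, leaving `d - 1` free entries.
  let κ : E d → Σ _ : Fin d × Prop, Fin d → ℤ := fun y =>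
    ⟨(i y, 0 ≤ y (i y)), fun l => if l = i y then 0 else ⌊y l / (η * R)⌋⟩
  let F : Finset (Σ _ : Fin d × Prop, Fin d → ℤ) := (Finset.univ : Finset (Fin d × Prop)).sigma
    fun p => Fintype.piFinset fun l => if l = p.1 then {0} else
      Finset.Icc ⌊(y₀ l - ρ) / (η * R)⌋ ⌊(y₀ l + ρ) / (η * R)⌋
  have hρ0 : 0 < ρ := hR0.trans_le hρ
  refine ⟨F, κ, ?_, ?_, ?_⟩
  · rw [Finset.card_sigma, Nat.cast_sum]
    have h1 : ∀ p ∈ (Finset.univ : Finset (Fin d × Prop)),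
        ((Fintype.piFinset fun l => if l = p.1 then {0} else
          Finset.Icc ⌊(y₀ l - ρ) / (η * R)⌋ ⌊(y₀ l + ρ) / (η * R)⌋).card : ℝ) ≤
        ((2 / η + 2) * (ρ / R)) ^ (d - 1) := by
      intro p _
      rw [Fintype.card_piFinset, Nat.cast_prod, ← Finset.mul_prod_erase _ _ (Finset.mem_univ p.1)]
      simp only [if_true, Finset.card_singleton, Nat.cast_one, one_mul]
      have h2 : ∀ l ∈ Finset.univ.erase p.1, (((if l = p.1 then {0} else
          Finset.Icc ⌊(y₀ l - ρ) / (η * R)⌋ ⌊(y₀ l + ρ) / (η * R)⌋) : Finset ℤ).card : ℝ) ≤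
          (2 / η + 2) * (ρ / R) := by
        intro l hl
        rw [if_neg (Finset.ne_of_mem_erase hl)]
        refine (card_Icc_floor_le (by gcongr; linarith)).trans ?_
        have h3 : 1 ≤ ρ / R := by rwa [one_le_div hR0]
        have h4 : (y₀ l + ρ) / (η * R) - (y₀ l - ρ) / (η * R) = 2 / η * (ρ / R) := by
          field_simp; ring
        rw [h4]
        linarith
      refine (Finset.prod_le_prod (fun _ _ => by positivity) h2).trans_eq ?_
      rw [Finset.prod_const, Finset.card_erase_of_mem (Finset.mem_univ _), Finset.card_univ,
        Fintype.card_fin]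
    refine (Finset.sum_le_card_nsmul _ _ _ h1).trans_eq ?_
    rw [Finset.card_univ, Fintype.card_prod, Fintype.card_fin, Fintype.card_prop, nsmul_eq_mul,
      mul_pow]
    push_cast
    ring
  · intro y hy
    simp only [F, κ, Finset.mem_sigma, Finset.mem_univ, true_and, Fintype.mem_piFinset]
    intro l
    split_ifs with h
    · simp
    · have h1 : |y l - y₀ l| ≤ ρ := (abs_coord_le_norm (y - y₀) l).trans hy
      rw [abs_le] at h1
      rw [Finset.mem_Icc]
      constructor <;> apply Int.floor_mono <;> gcongr <;> linarith
  · intro x y hx hy hxy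
    simp only [κ, Sigma.mk.injEq, Prod.mk.injEq, heq_eq_eq] at hxy
    obtain ⟨⟨h1, h2⟩, h3⟩ := hxy
    have hxi := hi x
    rw [h1] at hxi h2 h3
    refine (norm_sub_lt_of_coords hlam2 hdel1 hR0 hη0 hR2 hRlam hx hy hxi (hi y)
      (iff_of_eq h2) fun l hl => ?_).trans_lt ?_
    · have h4 := congrFun h3 l
      simp only [hl, if_false] at h4
      have h5 := Int.abs_sub_lt_one_of_floor_eq_floor h4
      rwa [← sub_div, abs_div, abs_of_pos (by positivity : 0 < η * R),
        div_lt_one (by positivity)] at h5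
    · rw [← hD, hη]
      gcongr
      rw [mul_div_assoc', div_lt_iff₀ (by positivity)]
      nlinarith

lemma mem_shell_iff {d : ℕ} {Q : QuadraticForm ℝ (E d)} {A : E d ≃ₗ[ℝ] E d}
    (hA : ∀ x, Q x = ‖A x‖ ^ 2) {lam del : ℝ} {x : E d} :
    x ∈ shell Q lam del ↔ |‖A x‖ - lam| < del := by
  rw [shell, Set.mem_ofPred_eq, hA, Real.sqrt_sq (norm_nonneg _)]

/-- A bound for the number of caps centred in a ball. -/
lemma exists_card_caps_le {d : ℕ} (hd : 0 < d) {Q : QuadraticForm ℝ (E d)} {A : E d ≃ₗ[ℝ] E d}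
    (hA : ∀ x, Q x = ‖A x‖ ^ 2) :
    ∃ lam₀ C : ℝ, 2 ≤ lam₀ ∧ 0 < C ∧ ∀ lam del : ℝ, lam₀ ≤ lam → 0 < del → del < 1 →
      ∀ (M : ℕ) (𝒞 : Set (Set (E d))), IsCapDecomposition Q lam del M 𝒞 →
      ∀ (y₀ : E d) (ρ : ℝ), √(lam * del) ≤ ρ → ∀ S : Finset (Set (E d)),
      (∀ θ ∈ S, θ ∈ 𝒞 ∧ ∃ c ∈ shell Q lam del, θ = cap Q lam del c ∧ ‖A c - y₀‖ ≤ ρ) →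
      (S.card : ℝ) ≤ M * (C * (ρ / √(lam * del)) ^ (d - 1)) := by
  classical
  obtain ⟨a, ha, -, haA⟩ := exists_norm_equivalence A
  have ha0 : 0 < a := by linarith
  obtain ⟨lam₀, C, hlam₀, hC, h⟩ := exists_cell_cover hd (ε := 1 / a) (by positivity)
  refine ⟨lam₀, C, hlam₀, hC, fun lam del hlam hdel hdel1 M 𝒞 h𝒞 y₀ ρ hρ S hS => ?_⟩
  obtain ⟨F, κ, hF, hκ, hsep⟩ := h lam del hlam hdel hdel1 y₀ ρ hρ
  choose! c hc using fun θ hθ => (hS θ hθ).2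
  have hcard := Finset.card_le_mul_card_image_of_maps_to (s := S) (t := F) (f := fun θ => κ (A (c θ)))
    (fun θ hθ => hκ _ (hc θ hθ).2.2) M ?_
  · calc (S.card : ℝ) ≤ M * F.card := by exact_mod_cast hcard
      _ ≤ _ := by gcongr
  · intro b _
    rcases Finset.eq_empty_or_nonempty (S.filter fun θ => κ (A (c θ)) = b) with h0 | ⟨θ₀, hθ₀⟩
    · rw [h0]; simp
    · rw [Finset.mem_filter] at hθ₀
      -- Centres in one cell are closer than the cap radius, so all these caps contain `c θ₀` and
      -- there are at most `M` of them.
      have hsub : ((S.filter fun θ => κ (A (c θ)) = b : Finset (Set (E d))) : Set (Set (E d))) ⊆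
          {θ ∈ 𝒞 | c θ₀ ∈ θ} := by
        intro θ hθ
        rw [Finset.mem_coe, Finset.mem_filter] at hθ
        refine ⟨(hS θ hθ.1).1, ?_⟩
        rw [(hc θ hθ.1).2.1]
        refine ⟨?_, (hc θ₀ hθ₀.1).1⟩
        have h1 := hsep _ _ ((mem_shell_iff hA).mp (hc θ₀ hθ₀.1).1)
          ((mem_shell_iff hA).mp (hc θ hθ.1).1) (hθ₀.2.trans hθ.2.symm)
        rw [Metric.mem_ball, dist_eq_norm]
        refine (haA _).trans_lt ?_
        rw [map_sub]
        calc a * ‖A (c θ₀) - A (c θ)‖ < a * (1 / a * √(lam * del)) := by gcongr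
          _ = _ := by field_simp
      have h1 := (Set.encard_le_encard hsub).trans (h𝒞.overlap (c θ₀))
      rw [Set.encard_coe_eq_coe_finsetCard] at h1
      exact_mod_cast h1

lemma exists_finset_card_eq_latticeCount {d : ℕ} {θ : Set (E d)} (hθ : Bornology.IsBounded θ) :
    ∃ F : Finset (Fin d → ℤ), F.card = latticeCount θ ∧ ∀ z, z ∈ F ↔ intVec z ∈ θ := by
  obtain ⟨r, hr⟩ := hθ.exists_norm_le
  have hfin : {z : Fin d → ℤ | intVec z ∈ θ}.Finite :=
    (finite_norm_intVec_le d r).subset fun z hz => hr _ hz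
  refine ⟨hfin.toFinset, ?_, by simp⟩
  rw [← Set.ncard_eq_toFinset_card _ hfin, latticeCount,
    ← Set.ncard_image_of_injective _ intVec_injective]
  congr 1
  ext x
  simp only [Set.mem_image, Set.mem_ofPred_eq, Set.mem_inter_iff, mem_integerPoints_iff]
  constructor
  · rintro ⟨z, hz, rfl⟩; exact ⟨⟨z, rfl⟩, hz⟩
  · rintro ⟨⟨z, rfl⟩, hz⟩; exact ⟨z, hz, rfl⟩

lemma isBounded_cap {d : ℕ} (Q : QuadraticForm ℝ (E d)) (lam del : ℝ) (c : E d) :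
    Bornology.IsBounded (cap Q lam del c) :=
  Metric.isBounded_ball.subset Set.inter_subset_left

/-! ### Flatness of caps and the direction of the dual vector -/

/-- Caps are flat. -/
lemma abs_inner_sub_le_of_mem_shell {d : ℕ} {x c : E d} {lam del r : ℝ} (hdel : 0 < del)
    (hlam : del ≤ lam) (hx : |‖x‖ - lam| < del) (hc : |‖c‖ - lam| < del)
    (hr : ‖x - c‖ ^ 2 ≤ r * (lam * del)) :
    |⟪c, x - c⟫_ℝ| ≤ (4 + r) * (lam * del) := by
  have h1 : ‖x‖ ^ 2 = ‖c‖ ^ 2 + 2 * ⟪c, x - c⟫_ℝ + ‖x - c‖ ^ 2 := by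
    rw [← norm_add_sq_real, add_sub_cancel]
  have h2 : |‖x‖ ^ 2 - ‖c‖ ^ 2| ≤ 8 * (lam * del) := by
    rw [abs_lt] at hx hc
    have h3 : |‖x‖ - ‖c‖| ≤ 2 * del := by rw [abs_le]; constructor <;> linarith
    have h4 : |‖x‖ + ‖c‖| ≤ 4 * lam := by
      rw [abs_of_nonneg (by positivity)]; linarith
    rw [show ‖x‖ ^ 2 - ‖c‖ ^ 2 = (‖x‖ - ‖c‖) * (‖x‖ + ‖c‖) by ring, abs_mul]
    calc _ ≤ 2 * del * (4 * lam) := by gcongr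
      _ = _ := by ring
  have h5 : 0 ≤ ‖x - c‖ ^ 2 := sq_nonneg _
  rw [abs_le] at h2 ⊢
  constructor <;> linarith

/-- A vector whose pairing with vectors orthogonal to `e` is small points almost in the
direction of `e`. -/
lemma norm_sub_direction_le {d : ℕ} {p e : E d} {t R del lam : ℝ} (hR : 1 ≤ R) (hdel : 0 < del)
    (hdel1 : del < 1) (ht : 0 ≤ t) (hlam : 0 < lam) (hp : p ≠ 0) (he1 : 1 / 2 ≤ ‖e‖)
    (he2 : ‖e‖ ≤ 2) (he : |lam * ‖e‖ - lam| ≤ del) (hpe : 0 ≤ ⟪p, e⟫_ℝ)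
    (h : ∀ y, |⟪p, y⟫_ℝ| ≤ t * (‖y‖ / R + 2 * |⟪e, y⟫_ℝ| / del)) :
    ‖p‖ ≤ 5 * t / del ∧ ‖lam • e - lam • (‖p‖⁻¹ • p)‖ ≤ del + 2 * lam * t / (R * ‖p‖) := by
  have hp0 : 0 < ‖p‖ := norm_pos_iff.mpr hp
  have hR0 : 0 < R := by linarith
  have he0 : 0 < ‖e‖ := by linarith
  constructor
  -- Test `h` on `p` itself; the constant is `5 = 1 + 2 * 2`, using `del < 1 ≤ R`.
  · have h1 := h p
    rw [real_inner_self_eq_norm_sq, abs_of_nonneg (sq_nonneg _)] at h1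
    have h2 : |⟪e, p⟫_ℝ| ≤ 2 * ‖p‖ := (abs_real_inner_le_norm _ _).trans (by gcongr)
    have h3 : ‖p‖ / R ≤ ‖p‖ / del := by gcongr; linarith
    have h4 : 2 * |⟪e, p⟫_ℝ| / del ≤ 2 * (2 * ‖p‖) / del := by gcongr
    have h5 : ‖p‖ ^ 2 ≤ t * (‖p‖ / del + 2 * (2 * ‖p‖) / del) := h1.trans (by gcongr)
    refine le_of_mul_le_mul_right ?_ hp0
    calc ‖p‖ * ‖p‖ = ‖p‖ ^ 2 := by ring
      _ ≤ _ := h5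
      _ = _ := by ring
  · set β := ⟪p, e⟫_ℝ / ‖e‖ ^ 2 with hβ
    have hβ0 : 0 ≤ β := by positivity
    -- Testing `h` on the component `q` of `p` orthogonal to `e` kills the large term and leaves
    -- `‖q‖ ≤ t / R`.
    set q := p - β • e with hq
    have hqe : ⟪e, q⟫_ℝ = 0 := by
      rw [hq, inner_sub_right, inner_smul_right, real_inner_self_eq_norm_sq, hβ,
        real_inner_comm]
      field_simp
      ring
    have hpq : ⟪p, q⟫_ℝ = ‖q‖ ^ 2 := by
      have : p = β • e + q := by rw [hq]; abel
      conv_lhs => rw [this]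
      rw [inner_add_left, inner_smul_left, hqe, real_inner_self_eq_norm_sq]
      simp
    have hqt : ‖q‖ ≤ t / R := by
      have h1 := h q
      rw [hpq, hqe, abs_of_nonneg (sq_nonneg _)] at h1
      rcases (norm_nonneg q).eq_or_lt with h0 | h0
      · rw [← h0]; positivity
      · refine le_of_mul_le_mul_right ?_ h0
        calc ‖q‖ * ‖q‖ = ‖q‖ ^ 2 := by ring
          _ ≤ _ := h1
          _ = _ := by simp; ring
    have h1 : |‖p‖ - β * ‖e‖| ≤ ‖q‖ := by
      have := abs_norm_sub_norm_le p (β • e)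
      rwa [norm_smul, Real.norm_of_nonneg hβ0] at this
    have h2 : ‖(‖p‖ * ‖e‖⁻¹) • e - p‖ ≤ 2 * ‖q‖ := by
      have h3 : (‖p‖ * ‖e‖⁻¹) • e - p = ((‖p‖ - β * ‖e‖) * ‖e‖⁻¹) • e - q := by
        have h4 : (‖p‖ - β * ‖e‖) * ‖e‖⁻¹ = ‖p‖ * ‖e‖⁻¹ - β := by field_simp
        rw [h4, hq, sub_smul]
        abel
      rw [h3]
      refine (norm_sub_le _ _).trans ?_
      rw [norm_smul, Real.norm_eq_abs, abs_mul, abs_of_pos (inv_pos.mpr he0), mul_assoc,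
        inv_mul_cancel₀ he0.ne']
      linarith
    have h3 : lam • e - lam • (‖p‖⁻¹ • p) = ((lam * ‖e‖ - lam) * ‖e‖⁻¹) • e +
        (lam * ‖p‖⁻¹) • ((‖p‖ * ‖e‖⁻¹) • e - p) := by
      rw [smul_sub, smul_smul, smul_smul]
      have h4 : (lam * ‖e‖ - lam) * ‖e‖⁻¹ = lam - lam * ‖e‖⁻¹ := by field_simp
      have h5 : lam * ‖p‖⁻¹ * (‖p‖ * ‖e‖⁻¹) = lam * ‖e‖⁻¹ := by field_simp
      rw [h4, h5, sub_smul]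
      abel
    rw [h3]
    refine (norm_add_le _ _).trans (add_le_add ?_ ?_)
    · rw [norm_smul, Real.norm_eq_abs, abs_mul, abs_of_pos (inv_pos.mpr he0), mul_assoc,
        inv_mul_cancel₀ he0.ne', mul_one]
      exact he
    · rw [norm_smul, Real.norm_of_nonneg (by positivity)]
      calc lam * ‖p‖⁻¹ * ‖(‖p‖ * ‖e‖⁻¹) • e - p‖ ≤ lam * ‖p‖⁻¹ * (2 * (t / R)) := by
            gcongr; linarith
        _ = _ := by field_simp

/-- A cap with many integer points has its centre close to a direction given by a short integer
vector. -/
lemma exists_dual_of_cap {d : ℕ} (hd : 0 < d) {Q : QuadraticForm ℝ (E d)} {A : E d ≃ₗ[ℝ] E d}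
    (hA : ∀ x, Q x = ‖A x‖ ^ 2) :
    ∃ (K C : ℝ) (dir : (Fin d → ℤ) → E d), 0 < K ∧ 0 < C ∧ ∀ lam del : ℝ, 2 ≤ lam →
      1 / lam ≤ del → del < 1 → ∀ c ∈ shell Q lam del, ∀ (k : ℕ) (T : ℝ), 1 ≤ k → k + 1 ≤ d →
      K < T → K < √(lam * del) ^ k * del * T →
      √(lam * del) ^ (d - 1) * del * T < 2 * latticeCount (cap Q lam del c) →
      ∃ w ≠ 0, ‖intVec w‖ ≤ C / (T ^ (1 / (k : ℝ)) * del) ∧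
        ‖A c - lam • dir w‖ ≤
          2 * √(lam * del) * (C / (T ^ (1 / (k : ℝ)) * del) / ‖intVec w‖) := by
  obtain ⟨a, ha, hAa, haA⟩ := exists_norm_equivalence A
  have ha0 : 0 < a := by linarith
  set b := 2 * (4 + a ^ 2) with hb
  obtain ⟨K, C₀, hK, hC₀, hdual⟩ := exists_dual_vector_of_many_points hd A b (by positivity)
  -- The inverse adjoint of `A` carries pairings with `w` to the coordinates in which the shell is
  -- round.
  let G : E d →ₗ[ℝ] E d := LinearMap.adjoint A.symm.toLinearMap
  have hG : ∀ w v, ⟪G w, A v⟫_ℝ = ⟪w, v⟫_ℝ := by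
    intro w v
    simp [G, LinearMap.adjoint_inner_left]
  have hGnorm : ∀ w, ‖w‖ ≤ a * ‖G w‖ := by
    intro w
    rcases (norm_nonneg w).eq_or_lt with h0 | h0
    · rw [← h0]; positivity
    · refine le_of_mul_le_mul_right ?_ h0
      calc ‖w‖ * ‖w‖ = ⟪G w, A w⟫_ℝ := by rw [hG, real_inner_self_eq_norm_mul_norm]
        _ ≤ ‖G w‖ * ‖A w‖ := real_inner_le_norm _ _
        _ ≤ ‖G w‖ * (a * ‖w‖) := by gcongr; exact hAa w
        _ = _ := by ring
  refine ⟨K, 5 * a * C₀, fun w => ‖G (intVec w)‖⁻¹ • G (intVec w), hK, by positivity, ?_⟩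
  intro lam del hlam hdel hdel1 c hc k T hk hkd hT hTR hcount
  have hlam0 : 0 < lam := by linarith
  have hdel0 : 0 < del := lt_of_lt_of_le (by positivity) hdel
  have hT0 : 0 < T := hK.trans hT
  rw [div_le_iff₀ hlam0] at hdel
  have hR1 : 1 ≤ √(lam * del) := by rw [Real.one_le_sqrt]; linarith
  have hR2 : √(lam * del) ^ 2 = lam * del := Real.sq_sqrt (by positivity)
  have hc' := (mem_shell_iff hA).mp hc
  set R := √(lam * del) with hR
  have hR0 : 0 < R := by linarith
  set e := lam⁻¹ • A c with he
  have hlame : lam * ‖e‖ = ‖A c‖ := by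
    rw [he, norm_smul, norm_inv, Real.norm_of_nonneg hlam0.le, mul_inv_cancel_left₀ hlam0.ne']
  have hcc := abs_lt.mp hc'
  have he1 : 1 / 2 ≤ ‖e‖ := by
    refine le_of_mul_le_mul_left ?_ hlam0
    linarith
  have he2 : ‖e‖ ≤ 2 := by
    refine le_of_mul_le_mul_left ?_ hlam0
    linarith
  obtain ⟨F, hFcard, hF⟩ := exists_finset_card_eq_latticeCount (isBounded_cap Q lam del c)
  have hpts : ∀ x ∈ cap Q lam del c, ‖A (x - c)‖ ≤ b / 2 * R ∧
      |⟪e, A (x - c)⟫_ℝ| ≤ b / 2 * del := by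
    rintro x ⟨hx1, hx2⟩
    rw [Metric.mem_ball, dist_eq_norm] at hx1
    have h1 : ‖A (x - c)‖ ≤ a * R := (hAa _).trans (by gcongr)
    constructor
    · refine h1.trans ?_
      gcongr
      rw [hb]
      nlinarith
    · have h2 : ‖A x - A c‖ ^ 2 ≤ a ^ 2 * (lam * del) := by
        rw [← map_sub, ← hR2, ← mul_pow]
        gcongr
      have h3 := abs_inner_sub_le_of_mem_shell hdel0 (by linarith)
        ((mem_shell_iff hA).mp hx2) hc' h2
      rw [he, inner_smul_left, abs_mul, map_sub]
      simp only [conj_trivial, abs_inv, abs_of_pos hlam0]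
      rw [inv_mul_le_iff₀ hlam0]
      refine h3.trans_eq ?_
      rw [hb]
      ring
  have hFne : F.Nonempty := by
    rw [Finset.nonempty_iff_ne_empty]
    rintro rfl
    rw [← hFcard, Finset.card_empty] at hcount
    have : 0 ≤ R ^ (d - 1) * del * T := by positivity
    norm_num at hcount
    linarith
  obtain ⟨z₀, hz₀⟩ := hFne
  have hz₀' := hpts _ ((hF z₀).mp hz₀)
  -- The centre `c` need not be integral, so differences with one lattice point `z₀` of the cap are
  -- used; this doubles the box from `b / 2` to `b`.
  obtain ⟨w₁, hw₁0, hw₁⟩ := hdual R del e hR1 hdel0 he1 he2 (F.image fun z => z - z₀)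
    (by
      intro y hy
      obtain ⟨z, hz, rfl⟩ := Finset.mem_image.mp hy
      have hz' := hpts _ ((hF z).mp hz)
      have h1 : A (intVec (z - z₀)) = A (intVec z - c) - A (intVec z₀ - c) := by
        rw [intVec_sub, ← map_sub]; congr 1; abel
      rw [h1]
      constructor
      · refine (norm_sub_le _ _).trans ?_
        linarith
      · rw [inner_sub_right]
        refine (abs_sub _ _).trans ?_
        linarith)
    k T hk hkd hT hTR (by
      rw [Finset.card_image_of_injective _ sub_left_injective, hFcard]
      exact hcount)
  -- Choose the sign of the dual vector so that it points towards the centre, not its antipode.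
  obtain ⟨w, hw0, hw, hwe⟩ : ∃ w : Fin d → ℤ, w ≠ 0 ∧ (∀ v, |⟪intVec w, v⟫_ℝ| ≤
      C₀ / T ^ (1 / (k : ℝ)) * (‖A v‖ / R + 2 * |⟪e, A v⟫_ℝ| / del)) ∧
      0 ≤ ⟪G (intVec w), e⟫_ℝ := by
    rcases le_total 0 ⟪G (intVec w₁), e⟫_ℝ with h | h
    · exact ⟨w₁, hw₁0, hw₁, h⟩
    · refine ⟨-w₁, neg_ne_zero.mpr hw₁0, fun v => ?_, ?_⟩
      · rw [intVec_neg, inner_neg_left, abs_neg]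
        exact hw₁ v
      · rw [intVec_neg, map_neg, inner_neg_left]
        linarith
  set s := T ^ (1 / (k : ℝ)) with hs
  have hs0 : 0 < s := Real.rpow_pos_of_pos hT0 _
  have hwnorm := one_le_norm_intVec hw0
  have hw0' : 0 < ‖intVec w‖ := by linarith
  have hGw := hGnorm (intVec w)
  have hp : 0 < ‖G (intVec w)‖ := by
    by_contra! h
    nlinarith
  obtain ⟨h1, h2⟩ := norm_sub_direction_le (p := G (intVec w)) (e := e) (t := C₀ / s) hR1 hdel0
    hdel1 (by positivity) hlam0 (norm_pos_iff.mp hp) he1 he2 (by rw [hlame]; exact hc'.le) hwe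
    (fun y => by
      obtain ⟨v, rfl⟩ := A.surjective y
      rw [hG]
      exact hw v)
  have hX : ‖intVec w‖ ≤ 5 * a * C₀ / (s * del) := by
    refine hGw.trans ?_
    calc a * ‖G (intVec w)‖ ≤ a * (5 * (C₀ / s) / del) := by gcongr
      _ = _ := by field_simp
  refine ⟨w, hw0, hX, ?_⟩
  have h3 : A c = lam • e := by rw [he, smul_smul, mul_inv_cancel₀ hlam0.ne', one_smul]
  rw [h3]
  refine h2.trans ?_
  set X := 5 * a * C₀ / (s * del) with hXdef
  -- Since `del < 1 ≤ R`, the radial error `del` is absorbed into one copy of `R * (X / ‖intVec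
  -- w‖)`; the angular error gives the other.
  have h4 : 1 ≤ X / ‖intVec w‖ := by rwa [one_le_div hw0']
  have h5 : R * 1 ≤ R * (X / ‖intVec w‖) := by gcongr
  have h6 : 2 * lam * (C₀ / s) / (R * ‖G (intVec w)‖) ≤ R * (X / ‖intVec w‖) := by
    have h7 : 1 / ‖G (intVec w)‖ ≤ a / ‖intVec w‖ := by
      rw [div_le_div_iff₀ hp hw0']; linarith
    have h8 : lam / R = R / del := by
      rw [div_eq_div_iff hR0.ne' hdel0.ne', ← hR2, sq]
    calc 2 * lam * (C₀ / s) / (R * ‖G (intVec w)‖)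
        = 2 * (lam / R) * (C₀ / s) * (1 / ‖G (intVec w)‖) := by field_simp
      _ ≤ 2 * (lam / R) * (C₀ / s) * (a / ‖intVec w‖) := by gcongr
      _ = 2 / 5 * (R * (X / ‖intVec w‖)) := by rw [h8, hXdef]; field_simp
      _ ≤ 1 * (R * (X / ‖intVec w‖)) := by gcongr; norm_num
      _ = _ := one_mul _
  linarith

/-! ### Summation over dual vectors and the bound for the classes -/

/-- Summation over integer vectors, ordered by the size of their largest coordinate. -/
lemma card_le_of_fiber_bound {d : ℕ} (hd : 0 < d) {ι : Type*} (S : Finset ι)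
    (w : ι → Fin d → ℤ) {X B : ℝ} (hX : 0 ≤ X) (hB : 0 ≤ B)
    (hw : ∀ θ ∈ S, w θ ≠ 0 ∧ ‖intVec (w θ)‖ ≤ X)
    (hfib : ∀ (v : Fin d → ℤ) (r : ℝ), 1 ≤ r → r ≤ X → r ≤ ‖intVec v‖ →
      ((S.filter fun θ => w θ = v).card : ℝ) ≤ B * (X / r) ^ (d - 1)) :
    (S.card : ℝ) ≤ 2 * d * 3 ^ (d - 1) * B * X ^ d := by
  classical
  -- The face of the cube of radius `r` has about `r ^ (d - 1)` points, cancelling the `r` in the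
  -- fibre bound. Each of the at most `X` radii thus contributes about `X ^ (d - 1)`.
  let P : ℕ → Fin d → Finset (Fin d → ℤ) := fun r i => Fintype.piFinset fun l =>
    if l = i then {(r : ℤ), -(r : ℤ)} else Finset.Icc (-(r : ℤ)) r
  have hP : ∀ (r : ℕ) (i : Fin d), 1 ≤ r → ((P r i).card : ℝ) ≤ 2 * (3 * r) ^ (d - 1) := by
    intro r i hr
    rw [Fintype.card_piFinset, Nat.cast_prod, ← Finset.mul_prod_erase _ _ (Finset.mem_univ i)]
    simp only [if_true]
    have h1 : ∀ l ∈ Finset.univ.erase i, (((if l = i then {(r : ℤ), -(r : ℤ)} else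
        Finset.Icc (-(r : ℤ)) r) : Finset ℤ).card : ℝ) ≤ 3 * r := by
      intro l hl
      rw [if_neg (Finset.ne_of_mem_erase hl), Int.card_Icc]
      have : ((r : ℤ) + 1 - -(r : ℤ)).toNat ≤ 3 * r := by omega
      exact_mod_cast this
    have h2 : ((({(r : ℤ), -(r : ℤ)} : Finset ℤ).card : ℕ) : ℝ) ≤ 2 := by
      exact_mod_cast Finset.card_le_two
    refine mul_le_mul h2 ?_ (by positivity) (by norm_num)
    refine (Finset.prod_le_prod (fun _ _ => by positivity) h1).trans_eq ?_
    rw [Finset.prod_const, Finset.card_erase_of_mem (Finset.mem_univ _), Finset.card_univ,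
      Fintype.card_fin]
  have hcover : S ⊆ (Finset.Icc 1 ⌊X⌋₊ ×ˢ (Finset.univ : Finset (Fin d))).biUnion
      fun p => S.filter fun θ => w θ ∈ P p.1 p.2 := by
    intro θ hθ
    obtain ⟨h0, hle⟩ := hw θ hθ
    have : Nonempty (Fin d) := ⟨⟨0, hd⟩⟩
    obtain ⟨i, -, hi⟩ := Finset.exists_max_image Finset.univ (fun i => |w θ i|)
      Finset.univ_nonempty
    obtain ⟨i', hi'⟩ := Function.ne_iff.mp h0
    have hpos : 1 ≤ |w θ i| := (Int.one_le_abs hi').trans (hi i' (Finset.mem_univ _))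
    simp only [Finset.mem_biUnion, Finset.mem_product, Finset.mem_univ, and_true,
      Finset.mem_filter, Finset.mem_Icc]
    have hne : w θ i ≠ 0 := fun h => by simp [h] at hpos
    refine ⟨((w θ i).natAbs, i), ⟨by omega, ?_⟩, hθ, ?_⟩
    · refine Nat.le_floor ?_
      refine le_trans ?_ hle
      refine le_trans ?_ (abs_coord_le_norm _ i)
      rw [intVec_apply, Nat.cast_natAbs, Int.cast_abs]
    · rw [Fintype.mem_piFinset]
      intro l
      have hl := hi l (Finset.mem_univ _)
      split_ifs with h
      · subst h
        rw [Finset.mem_insert, Finset.mem_singleton]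
        omega
      · rw [Finset.mem_Icc, ← abs_le, Int.natCast_natAbs]
        exact hl
  have hterm : ∀ p ∈ Finset.Icc 1 ⌊X⌋₊ ×ˢ (Finset.univ : Finset (Fin d)),
      ((S.filter fun θ => w θ ∈ P p.1 p.2).card : ℝ) ≤ 2 * 3 ^ (d - 1) * B * X ^ (d - 1) := by
    rintro ⟨r, i⟩ hp
    simp only [Finset.mem_product, Finset.mem_univ, and_true, Finset.mem_Icc] at hp
    obtain ⟨hr1, hr2⟩ := hp
    have hr1' : (1 : ℝ) ≤ r := by exact_mod_cast hr1
    have hrX : (r : ℝ) ≤ X := (Nat.cast_le.mpr hr2).trans (Nat.floor_le hX)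
    have h1 : (S.filter fun θ => w θ ∈ P r i).card = ∑ v ∈ P r i,
        ((S.filter fun θ => w θ ∈ P r i).filter fun θ => w θ = v).card :=
      Finset.card_eq_sum_card_fiberwise fun θ hθ => (Finset.mem_filter.mp hθ).2
    simp only
    rw [h1, Nat.cast_sum]
    have h2 : ∀ v ∈ P r i, ((((S.filter fun θ => w θ ∈ P r i).filter fun θ => w θ = v).card : ℕ) : ℝ) ≤
        B * (X / r) ^ (d - 1) := by
      intro v hv
      have h3 : (r : ℝ) ≤ ‖intVec v‖ := by
        refine le_trans ?_ (abs_coord_le_norm _ i)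
        have h4 := Fintype.mem_piFinset.mp hv i
        rw [if_pos rfl, Finset.mem_insert, Finset.mem_singleton] at h4
        rcases h4 with h4 | h4 <;> simp [h4]
      refine le_trans ?_ (hfib v r hr1' hrX h3)
      exact_mod_cast Finset.card_le_card
        (Finset.filter_subset_filter _ (Finset.filter_subset _ _))
    refine (Finset.sum_le_card_nsmul _ _ _ h2).trans ?_
    rw [nsmul_eq_mul]
    calc ((P r i).card : ℝ) * (B * (X / r) ^ (d - 1))
        ≤ 2 * (3 * r) ^ (d - 1) * (B * (X / r) ^ (d - 1)) := by gcongr; exact hP r i hr1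
      _ = 2 * 3 ^ (d - 1) * B * X ^ (d - 1) := by
        rw [mul_pow, div_pow]
        field_simp
  calc (S.card : ℝ) ≤ ∑ p ∈ Finset.Icc 1 ⌊X⌋₊ ×ˢ (Finset.univ : Finset (Fin d)),
        ((S.filter fun θ => w θ ∈ P p.1 p.2).card : ℝ) := by
        exact_mod_cast (Finset.card_le_card hcover).trans Finset.card_biUnion_le
    _ ≤ (Finset.Icc 1 ⌊X⌋₊ ×ˢ (Finset.univ : Finset (Fin d))).card •
        (2 * 3 ^ (d - 1) * B * X ^ (d - 1)) := Finset.sum_le_card_nsmul _ _ _ hterm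
    _ = (⌊X⌋₊ : ℝ) * (2 * d * 3 ^ (d - 1) * B * X ^ (d - 1)) := by
        rw [Finset.card_product, Nat.card_Icc, Finset.card_univ, Fintype.card_fin, nsmul_eq_mul]
        push_cast [Nat.add_sub_cancel]
        ring
    _ ≤ X * (2 * d * 3 ^ (d - 1) * B * X ^ (d - 1)) := by
        gcongr
        exact Nat.floor_le hX
    _ = 2 * d * 3 ^ (d - 1) * B * X ^ d := by
        obtain ⟨n, rfl⟩ : ∃ n, d = n + 1 := ⟨d - 1, by omega⟩
        simp only [Nat.add_sub_cancel]
        rw [pow_succ X]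
        ring

/-- Class 0 carries no lower bound on the count; `1 < 2 ^ j` excludes it. -/
lemma mem_capClass_of_one_lt {d : ℕ} {lam del : ℝ} {𝒞 : Set (Set (E d))} {j : ℕ}
    (hj : (1 : ℝ) < 2 ^ j) {θ : Set (E d)} (hθ : θ ∈ capClass lam del 𝒞 j) :
    θ ∈ 𝒞 ∧ √(lam * del) ^ (d - 1) * del * 2 ^ j < 2 * latticeCount θ := by
  cases j with
  | zero => simp at hj
  | succ j =>
    obtain ⟨h1, h2, -⟩ := hθ
    refine ⟨h1, ?_⟩
    rw [pow_succ]
    linarith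

/-- Attach to each cap its dual vector, bound the caps sharing one by `exists_card_caps_le`, and
sum. Finite subfamilies are used because finiteness of the class is itself a consequence. -/
lemma exists_card_subset_capClass_le {d : ℕ} (hd : 0 < d) {Q : QuadraticForm ℝ (E d)}
    {A : E d ≃ₗ[ℝ] E d} (hA : ∀ x, Q x = ‖A x‖ ^ 2) :
    ∃ lam₀ K C : ℝ, 2 ≤ lam₀ ∧ 1 ≤ K ∧ 0 < C ∧ ∀ lam del : ℝ, lam₀ ≤ lam → 1 / lam ≤ del →
      del < 1 → ∀ (M : ℕ) (𝒞 : Set (Set (E d))), IsCapDecomposition Q lam del M 𝒞 →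
      ∀ k : ℕ, 1 ≤ k → k + 1 ≤ d → ∀ j : ℕ, K < (2 : ℝ) ^ j →
      K < √(lam * del) ^ k * del * (2 : ℝ) ^ j →
      ∀ S : Finset (Set (E d)), (S : Set (Set (E d))) ⊆ capClass lam del 𝒞 j →
      (S.card : ℝ) ≤ C * M * ((2 : ℝ) ^ ((j : ℝ) / (k : ℝ)) * del) ^ (-(d : ℤ)) := by
  classical
  obtain ⟨lam₀, C₁, hlam₀, hC₁, hcaps⟩ := exists_card_caps_le hd hA
  obtain ⟨K, C₂, dir, hK, hC₂, hdual⟩ := exists_dual_of_cap hd hA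
  refine ⟨lam₀, max 1 K, 2 * d * 3 ^ (d - 1) * C₁ * 2 ^ (d - 1) * C₂ ^ d, hlam₀, le_max_left _ _,
    by positivity, ?_⟩
  intro lam del hlam hdel hdel1 M 𝒞 h𝒞 k hk hkd j hj hjR S hS
  have hlam0 : 0 < lam := by linarith
  have hdel0 : 0 < del := lt_of_lt_of_le (by positivity) hdel
  have hR0 : 0 < √(lam * del) := Real.sqrt_pos.mpr (by positivity)
  have hmem : ∀ θ ∈ S, θ ∈ 𝒞 ∧ √(lam * del) ^ (d - 1) * del * 2 ^ j < 2 * latticeCount θ :=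
    fun θ hθ => mem_capClass_of_one_lt ((le_max_left _ _).trans_lt hj) (hS hθ)
  choose! c hc using fun θ hθ => h𝒞.isCap θ (hmem θ hθ).1
  choose! w hw using fun θ (hθ : θ ∈ S) => hdual lam del (hlam₀.trans hlam) hdel hdel1 (c θ)
    (hc θ hθ).1 k (2 ^ j) hk hkd ((le_max_right _ _).trans_lt hj)
    ((le_max_right _ _).trans_lt hjR) (by rw [← (hc θ hθ).2]; exact (hmem θ hθ).2)
  have hs : ((2 : ℝ) ^ j) ^ (1 / (k : ℝ)) = (2 : ℝ) ^ ((j : ℝ) / (k : ℝ)) := by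
    rw [← Real.rpow_natCast, ← Real.rpow_mul (by norm_num), mul_one_div]
  rw [hs] at hw
  set s := (2 : ℝ) ^ ((j : ℝ) / (k : ℝ))
  have hs0 : 0 < s := Real.rpow_pos_of_pos (by norm_num) _
  set X := C₂ / (s * del) with hX
  have hX0 : 0 < X := by positivity
  refine (card_le_of_fiber_bound hd S w hX0.le (B := M * (C₁ * 2 ^ (d - 1))) (by positivity)
    (fun θ hθ => ⟨(hw θ hθ).1, (hw θ hθ).2.1⟩) ?_).trans_eq ?_
  · intro v r hr1 hrX hrv
    have hr0 : 0 < r := by linarith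
    have hXr : 1 ≤ X / r := by rwa [one_le_div hr0]
    refine (hcaps lam del hlam hdel0 hdel1 M 𝒞 h𝒞 (lam • dir v) (2 * √(lam * del) * (X / r)) ?_
      (S.filter fun θ => w θ = v) ?_).trans_eq ?_
    · nlinarith
    · intro θ hθ
      obtain ⟨hθS, rfl⟩ := Finset.mem_filter.mp hθ
      refine ⟨(hmem θ hθS).1, c θ, (hc θ hθS).1, (hc θ hθS).2, (hw θ hθS).2.2.trans ?_⟩
      gcongr
    · have h1 : 2 * √(lam * del) * (X / r) / √(lam * del) = 2 * (X / r) := by field_simp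
      rw [h1, mul_pow]
      ring
  · rw [hX, div_pow, zpow_neg, zpow_natCast]
    ring

/-- For bounded `lam` there are boundedly many integer points in the shell. -/
lemma exists_ncard_shell_le {d : ℕ} {Q : QuadraticForm ℝ (E d)} {A : E d ≃ₗ[ℝ] E d}
    (hA : ∀ x, Q x = ‖A x‖ ^ 2) (lam₀ : ℝ) :
    ∃ N : ℝ, 0 < N ∧ ∀ lam del : ℝ, lam ≤ lam₀ → del < 1 → ∀ θ ⊆ shell Q lam del,
      (latticeCount θ : ℝ) ≤ N := by
  obtain ⟨a, ha, -, haA⟩ := exists_norm_equivalence A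
  have hfin := (finite_norm_intVec_le d (a * (lam₀ + 1))).image intVec
  refine ⟨(intVec '' {z : Fin d → ℤ | ‖intVec z‖ ≤ a * (lam₀ + 1)}).ncard + 1, by positivity,
    fun lam del hlam hdel θ hθ => ?_⟩
  have h : (integerPoints d ∩ θ).ncard ≤ _ := Set.ncard_le_ncard (t := intVec '' _) ?_ hfin
  · rw [latticeCount]
    have h' : ((integerPoints d ∩ θ).ncard : ℝ) ≤ _ := Nat.cast_le.mpr h
    linarith
  · rintro x ⟨hx, hxθ⟩
    obtain ⟨z, rfl⟩ := mem_integerPoints_iff.mp hx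
    refine ⟨z, ?_, rfl⟩
    have h1 := abs_lt.mp ((mem_shell_iff hA).mp (hθ hxθ))
    refine (haA _).trans ?_
    gcongr
    linarith

/-- For `lam ≤ lam₀` a cap holds at most `N` points while `√(lam * del) ^ (d - 1) * del ≥ 1 / lam₀`;
hence `K ≥ 2 * N * lam₀` makes the class empty there. -/
theorem exists_ncard_capClass_le {d : ℕ} (hd : 0 < d) {Q : QuadraticForm ℝ (E d)}
    {A : E d ≃ₗ[ℝ] E d} (hA : ∀ x, Q x = ‖A x‖ ^ 2) :
    ∃ K C : ℝ, 1 ≤ K ∧ 0 < C ∧ ∀ lam del : ℝ, 1 ≤ lam → 1 / lam ≤ del →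
      del < 1 → ∀ (M : ℕ) (𝒞 : Set (Set (E d))), IsCapDecomposition Q lam del M 𝒞 →
      ∀ k : ℕ, 1 ≤ k → k + 1 ≤ d → ∀ j : ℕ, K < (2 : ℝ) ^ j →
      K < √(lam * del) ^ k * del * (2 : ℝ) ^ j →
      (capClass lam del 𝒞 j).Finite ∧ ((capClass lam del 𝒞 j).ncard : ℝ) ≤
        C * M * ((2 : ℝ) ^ ((j : ℝ) / (k : ℝ)) * del) ^ (-(d : ℤ)) := by
  obtain ⟨lam₀, K, C, hlam₀, hK, hC, h⟩ := exists_card_subset_capClass_le hd hA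
  obtain ⟨N, hN, hsmall⟩ := exists_ncard_shell_le hA lam₀
  refine ⟨max K (2 * N * lam₀), C, le_max_of_le_left hK, hC, ?_⟩
  intro lam del hlam hdel hdel1 M 𝒞 h𝒞 k hk hkd j hj hjR
  have hlam0 : 0 < lam := by linarith
  have hdel0 : 0 < del := lt_of_lt_of_le (by positivity) hdel
  rcases le_total lam₀ lam with hl | hl
  · have hbound := h lam del hl hdel hdel1 M 𝒞 h𝒞 k hk hkd j ((le_max_left _ _).trans_lt hj)
      ((le_max_left _ _).trans_lt hjR)
    have hfin : (capClass lam del 𝒞 j).Finite := by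
      by_contra hinf
      obtain ⟨n, hn⟩ := exists_nat_gt (C * M * ((2 : ℝ) ^ ((j : ℝ) / (k : ℝ)) * del) ^ (-(d : ℤ)))
      obtain ⟨S, hS, hcard⟩ := Set.Infinite.exists_subset_card_eq hinf n
      have := hbound S hS
      rw [hcard] at this
      linarith
    refine ⟨hfin, ?_⟩
    have := hbound hfin.toFinset (by simp)
    rwa [← Set.ncard_eq_toFinset_card _ hfin] at this
  · have hempty : capClass lam del 𝒞 j = ∅ := by
      rw [Set.eq_empty_iff_forall_notMem]
      intro θ hθ
      obtain ⟨h1, h2⟩ := mem_capClass_of_one_lt (hK.trans_lt ((le_max_left _ _).trans_lt hj)) hθ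
      have h3 : θ ⊆ shell Q lam del := by
        rw [← h𝒞.sUnion_eq]
        exact Set.subset_sUnion_of_mem h1
      have h4 := hsmall lam del hl hdel1 θ h3
      have hR1 : 1 ≤ √(lam * del) := by
        rw [div_le_iff₀ hlam0] at hdel
        rw [Real.one_le_sqrt]
        linarith
      have h5 : 1 / lam₀ ≤ √(lam * del) ^ (d - 1) * del := by
        calc 1 / lam₀ ≤ 1 / lam := by gcongr
          _ ≤ del := hdel
          _ ≤ _ := le_mul_of_one_le_left hdel0.le (one_le_pow₀ hR1)
      have hj' := (le_max_right _ _).trans_lt hj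
      have h6 : 1 / lam₀ * 2 ^ j ≤ √(lam * del) ^ (d - 1) * del * 2 ^ j := by gcongr
      rw [div_mul_eq_mul_div, one_mul, div_le_iff₀ (by linarith)] at h6
      have h7 : √(lam * del) ^ (d - 1) * del * 2 ^ j * lam₀ ≤ 2 * N * lam₀ :=
        mul_le_mul_of_nonneg_right (by linarith) (by linarith)
      linarith
    rw [hempty]
    refine ⟨Set.finite_empty, ?_⟩
    rw [Set.ncard_empty, Nat.cast_zero]
    have : 0 < (2 : ℝ) ^ ((j : ℝ) / (k : ℝ)) := Real.rpow_pos_of_pos (by norm_num) _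
    positivity

/-! ### Integer points in the whole shell -/

/-- The shell has a decomposition into caps with overlap bounded in terms of `d`. -/
lemma exists_isCapDecomposition {d : ℕ} (Q : QuadraticForm ℝ (E d)) {lam del : ℝ}
    (h : 0 < lam * del) : ∃ 𝒞, IsCapDecomposition Q lam del ((2 * d + 5) ^ d) 𝒞 := by
  classical
  have hR : 0 < √(lam * del) := Real.sqrt_pos.mpr h
  set R := √(lam * del) with hRdef
  -- One cap per occupied cube of side `s`; the cube has ℓ¹-diameter at most `d * s < R`, so its cap
  -- covers its part of the shell.
  let s : ℝ := R / (d + 1)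
  have hs : 0 < s := by positivity
  have hsR : s * (d + 1) = R := by simp only [s]; field_simp
  let g : E d → Fin d → ℤ := fun x l => ⌊x l / s⌋
  have hex : ∀ γ ∈ g '' shell Q lam del, ∃ x, x ∈ shell Q lam del ∧ g x = γ := fun γ hγ => hγ
  choose! rep hrep using hex
  refine ⟨(fun γ => cap Q lam del (rep γ)) '' (g '' shell Q lam del), ?_, ?_, ?_⟩
  · rintro _ ⟨γ, hγ, rfl⟩
    exact ⟨rep γ, (hrep γ hγ).1, rfl⟩
  · refine Set.Subset.antisymm ?_ fun x hx => ?_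
    · rintro x ⟨_, ⟨γ, -, rfl⟩, hx⟩
      exact hx.2
    · have hγ : g x ∈ g '' shell Q lam del := ⟨x, hx, rfl⟩
      refine ⟨_, ⟨g x, hγ, rfl⟩, ?_, hx⟩
      rw [Metric.mem_ball, dist_eq_norm, ← hRdef]
      refine (norm_le_sum_abs _).trans_lt ?_
      refine (Finset.sum_le_card_nsmul _ _ s fun l _ => ?_).trans_lt ?_
      · have h1 := Int.abs_sub_lt_one_of_floor_eq_floor (congrFun (hrep _ hγ).2 l).symm
        rw [← sub_div, abs_div, abs_of_pos hs, div_lt_one hs] at h1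
        exact h1.le
      · rw [Finset.card_univ, Fintype.card_fin, nsmul_eq_mul, ← hsR]
        linarith
  · intro p
    let B : Finset (Fin d → ℤ) := Fintype.piFinset fun l =>
      Finset.Icc (g p l - (d + 2)) (g p l + (d + 2))
    have hsub : {θ ∈ (fun γ => cap Q lam del (rep γ)) '' (g '' shell Q lam del) | p ∈ θ} ⊆
        ((B.image fun γ => cap Q lam del (rep γ) : Finset (Set (E d))) : Set (Set (E d))) := by
      rintro _ ⟨⟨γ, hγ, rfl⟩, hp⟩
      rw [Finset.coe_image]
      refine ⟨γ, ?_, rfl⟩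
      rw [Finset.mem_coe, Fintype.mem_piFinset]
      intro l
      have h1 : ‖p - rep γ‖ < s * (d + 1) := by
        rw [hsR, hRdef, ← dist_eq_norm]
        exact hp.1
      have h2 : |p l - rep γ l| < s * (d + 1) := (abs_coord_le_norm (p - rep γ) l).trans_lt h1
      have h3 : |p l / s - rep γ l / s| < d + 1 := by
        rw [← sub_div, abs_div, abs_of_pos hs, div_lt_iff₀ hs]
        linarith
      have h4 : ⌊rep γ l / s⌋ = γ l := congrFun (hrep γ hγ).2 l
      rw [abs_lt] at h3
      have h5 := Int.floor_le (rep γ l / s)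
      have h6 := Int.lt_floor_add_one (rep γ l / s)
      have h7 := Int.floor_le (p l / s)
      have h8 := Int.lt_floor_add_one (p l / s)
      rw [h4] at h5 h6
      rw [Finset.mem_Icc]
      constructor
      · have : ((⌊p l / s⌋ - (d + 2) : ℤ) : ℝ) < γ l := by push_cast; linarith
        exact (Int.cast_lt.mp this).le
      · have : (γ l : ℝ) < ((⌊p l / s⌋ + (d + 2) : ℤ) : ℝ) := by push_cast; linarith
        exact (Int.cast_lt.mp this).le
    have hB : B.card = (2 * d + 5) ^ d := by
      rw [Fintype.card_piFinset]
      have : ∀ l ∈ (Finset.univ : Finset (Fin d)),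
          (Finset.Icc (g p l - ((d : ℤ) + 2)) (g p l + ((d : ℤ) + 2))).card = 2 * d + 5 := by
        intro l _
        rw [Int.card_Icc]
        omega
      rw [Finset.prod_congr rfl this, Finset.prod_const, Finset.card_univ, Fintype.card_fin]
    refine (Set.encard_le_encard hsub).trans ?_
    rw [Set.encard_coe_eq_coe_finsetCard]
    exact_mod_cast Finset.card_image_le.trans_eq hB

lemma finite_integerPoints_inter_shell {d : ℕ} {Q : QuadraticForm ℝ (E d)} {A : E d ≃ₗ[ℝ] E d}
    (hA : ∀ x, Q x = ‖A x‖ ^ 2) (lam del : ℝ) : (integerPoints d ∩ shell Q lam del).Finite := by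
  obtain ⟨a, ha, -, haA⟩ := exists_norm_equivalence A
  refine ((finite_norm_intVec_le d (a * (lam + del))).image intVec).subset ?_
  rintro x ⟨hx, hxs⟩
  obtain ⟨z, rfl⟩ := mem_integerPoints_iff.mp hx
  refine ⟨z, ?_, rfl⟩
  have h1 := abs_lt.mp ((mem_shell_iff hA).mp hxs)
  refine (haA _).trans ?_
  gcongr
  linarith

/-- Dyadic splitting of the number of integer points in a cap. -/
lemma latticeCount_le_of_dyadic {d : ℕ} {lam del V K : ℝ} {𝒞 : Set (Set (E d))}
    (hVdef : √(lam * del) ^ (d - 1) * del = V) (hV : 0 < V) (hK : 1 ≤ K)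
    {θ : Set (E d)} (hθ : θ ∈ 𝒞) {J : ℕ} (hJ : (latticeCount θ : ℝ) ≤ V * 2 ^ J) :
    (latticeCount θ : ℝ) ≤ K * (V + 1) + ∑ j ∈ Finset.range (J + 1),
      Set.indicator {θ | θ ∈ capClass lam del 𝒞 j ∧ K < 2 ^ j ∧ K < V * 2 ^ j}
        (fun _ => V * 2 ^ j) θ := by
  classical
  have hnn : ∀ j ∈ Finset.range (J + 1),
      0 ≤ Set.indicator {θ | θ ∈ capClass lam del 𝒞 j ∧ K < 2 ^ j ∧ K < V * 2 ^ j}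
        (fun _ => V * 2 ^ j) θ := fun j _ => Set.indicator_nonneg (fun _ _ => by positivity) _
  have hex : ∃ j, (latticeCount θ : ℝ) ≤ V * 2 ^ j := ⟨J, hJ⟩
  -- At the least such `j`, either the cap lies in a class to which the main bound applies, or `V *
  -- 2 ^ j` is at most `K * V` or `K`.
  obtain ⟨j, hj, hmin⟩ : ∃ j, (latticeCount θ : ℝ) ≤ V * 2 ^ j ∧
      ∀ i < j, V * 2 ^ i < (latticeCount θ : ℝ) :=
    ⟨Nat.find hex, Nat.find_spec hex, fun i hi => not_le.mp (Nat.find_min hex hi)⟩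
  have hjJ : j < J + 1 := by
    by_contra! h
    exact absurd hJ (not_le.mpr (hmin J (by omega)))
  by_cases hgood : K < 2 ^ j ∧ K < V * 2 ^ j
  · have hmem : θ ∈ capClass lam del 𝒞 j := by
      cases j with
      -- A count equal to `V` belongs to no class, but `K ≥ 1` rules out `j = 0` here.
      | zero =>
        have h := hgood.1
        rw [pow_zero] at h
        linarith
      | succ i =>
        refine ⟨hθ, ?_, ?_⟩
        · rw [hVdef]; exact hmin i (by omega)
        · rw [hVdef]; exact hj
    have h1 := Finset.single_le_sum hnn (Finset.mem_range.mpr hjJ)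
    have hm : θ ∈ {θ | θ ∈ capClass lam del 𝒞 j ∧ K < 2 ^ j ∧ K < V * 2 ^ j} := ⟨hmem, hgood⟩
    rw [Set.indicator_of_mem hm] at h1
    have h2 : 0 ≤ K * (V + 1) := by positivity
    linarith
  · have h1 : (latticeCount θ : ℝ) ≤ K * (V + 1) := by
      by_cases h2 : K < 2 ^ j
      · have h3 : V * 2 ^ j ≤ K := not_lt.mp fun h => hgood ⟨h2, h⟩
        have h4 : 0 ≤ K * V := by positivity
        linarith
      · have h3 : V * 2 ^ j ≤ V * K := by gcongr; exact not_lt.mp h2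
        linarith
    linarith [Finset.sum_nonneg hnn]

/-- With `k = d - 1 = n` the exponent of `2 ^ j` is `1 - (n + 1) / n = -1 / n`, hence the geometric
decay over classes. -/
lemma two_pow_mul_rpow_zpow {n : ℕ} (hn : 1 ≤ n) (del : ℝ) (j : ℕ) :
    (2 : ℝ) ^ j * ((2 : ℝ) ^ ((j : ℝ) / (n : ℝ)) * del) ^ (-((n + 1 : ℕ) : ℤ)) =
      ((2 : ℝ) ^ (-(1 / (n : ℝ)))) ^ j * (del ^ (n + 1))⁻¹ := by
  have hn0 : (n : ℝ) ≠ 0 := by positivity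
  rw [zpow_neg, zpow_natCast, mul_pow, mul_inv, ← mul_assoc]
  congr 1
  rw [← Real.rpow_natCast ((2 : ℝ) ^ ((j : ℝ) / (n : ℝ))), ← Real.rpow_mul (by norm_num),
    ← Real.rpow_neg (by norm_num), ← Real.rpow_natCast 2 j, ← Real.rpow_add (by norm_num),
    ← Real.rpow_natCast _ j, ← Real.rpow_mul (by norm_num)]
  congr 1
  push_cast
  field_simp
  ring

theorem exists_ncard_integerPoints_shell_le {d : ℕ} (hd : 2 ≤ d) {Q : QuadraticForm ℝ (E d)}
    {A : E d ≃ₗ[ℝ] E d} (hA : ∀ x, Q x = ‖A x‖ ^ 2) :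
    ∃ C : ℝ, 0 < C ∧ ∀ lam del : ℝ, 1 ≤ lam → 1 / lam ≤ del → del < 1 →
      ((integerPoints d ∩ shell Q lam del).ncard : ℝ) ≤
        C * (del * lam ^ (d - 1) + √(lam / del) ^ (d - 1)) := by
  classical
  obtain ⟨n, rfl⟩ : ∃ n, d = n + 1 := ⟨d - 1, by omega⟩
  have hn : 1 ≤ n := by omega
  simp only [Nat.add_sub_cancel]
  obtain ⟨lam₀, C₁, hlam₀, hC₁, hcaps⟩ := exists_card_caps_le (by omega) hA
  obtain ⟨K, C₂, hK, hC₂, hclass⟩ := exists_ncard_capClass_le (by omega) hA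
  obtain ⟨N, hN, hsmall⟩ := exists_ncard_shell_le hA lam₀
  set M : ℕ := (2 * (n + 1) + 5) ^ (n + 1) with hM
  have hM0 : 0 < (M : ℝ) := by positivity
  set q : ℝ := (2 : ℝ) ^ (-(1 / (n : ℝ))) with hq
  have hq0 : 0 ≤ q := Real.rpow_nonneg (by norm_num) _
  have hq1 : q < 1 := by
    apply Real.rpow_lt_one_of_one_lt_of_neg (by norm_num)
    rw [neg_lt_zero]
    positivity
  have hG : 0 < (1 - q)⁻¹ := by rw [inv_pos]; linarith
  set C₃ := M * (C₁ * 2 ^ n) * K with hC₃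
  set C₄ := C₂ * M * (1 - q)⁻¹ with hC₄
  have hC₃0 : 0 < C₃ := by positivity
  have hC₄0 : 0 < C₄ := by positivity
  refine ⟨N + C₃ + C₄, by positivity, fun lam del hlam hdel hdel1 => ?_⟩
  have hlam0 : 0 < lam := by linarith
  have hdel0 : 0 < del := lt_of_lt_of_le (by positivity) hdel
  have hlamdel : 1 ≤ lam * del := by rw [div_le_iff₀ hlam0] at hdel; linarith
  set D := √(lam / del) with hD
  have hD0 : 0 < D := Real.sqrt_pos.mpr (by positivity)
  rcases le_total lam lam₀ with hl | hl
  -- For bounded `lam` the count is bounded, while the main term is at least 1.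
  · have h1 := hsmall lam del hl hdel1 _ subset_rfl
    have h2 : 1 ≤ del * lam ^ n := by
      calc (1 : ℝ) ≤ del * lam := by linarith
        _ ≤ del * lam ^ n := by
          gcongr
          exact le_self_pow₀ hlam (by omega)
    calc ((integerPoints (n + 1) ∩ shell Q lam del).ncard : ℝ) ≤ N * 1 := by rw [mul_one]; exact h1
      _ ≤ (N + C₃ + C₄) * (del * lam ^ n + D ^ n) := by
        apply mul_le_mul (by linarith) _ (by norm_num) (by positivity)
        have : 0 < D ^ n := by positivity
        linarith
  · have hR0 : 0 < √(lam * del) := Real.sqrt_pos.mpr (by positivity)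
    have hR2 : √(lam * del) ^ 2 = lam * del := Real.sq_sqrt (by positivity)
    have hD2 : D ^ 2 = lam / del := Real.sq_sqrt (by positivity)
    have hRD : √(lam * del) = D * del := by
      rw [Real.sqrt_eq_iff_mul_self_eq (by positivity) (by positivity)]
      calc lam * del = lam / del * del ^ 2 := by field_simp
        _ = D * del * (D * del) := by rw [← hD2]; ring
    have hlamR : lam / √(lam * del) = D := by
      rw [hRD, div_eq_iff (by positivity)]
      calc lam = lam / del * del := by field_simp
        _ = D * (D * del) := by rw [← hD2]; ring
    obtain ⟨𝒞, h𝒞⟩ := exists_isCapDecomposition Q (by positivity : 0 < lam * del)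
    rw [← hM] at h𝒞
    set V := √(lam * del) ^ n * del with hV
    have hV0 : 0 < V := by positivity
    -- All centres lie in the ball of radius `2 * lam` about 0 in the coordinates `A`, and `lam /
    -- √(lam * del) = D`.
    have hcard : ∀ S : Finset (Set (E (n + 1))), (S : Set (Set (E (n + 1)))) ⊆ 𝒞 →
        (S.card : ℝ) ≤ M * (C₁ * 2 ^ n) * D ^ n := by
      intro S hS
      refine (hcaps lam del hl hdel0 hdel1 M 𝒞 h𝒞 0 (2 * lam) ?_ S fun θ hθ => ?_).trans_eq ?_
      · refine le_of_sq_le_sq ?_ (by positivity)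
        rw [hR2]
        nlinarith
      · obtain ⟨c, hc, rfl⟩ := h𝒞.isCap θ (hS hθ)
        refine ⟨hS hθ, c, hc, rfl, ?_⟩
        have := abs_lt.mp ((mem_shell_iff hA).mp hc)
        rw [sub_zero]
        linarith
      · rw [Nat.add_sub_cancel, mul_div_assoc, hlamR, mul_pow]
        ring
    have hfin : 𝒞.Finite := by
      by_contra hinf
      obtain ⟨m, hm⟩ := exists_nat_gt (M * (C₁ * 2 ^ n) * D ^ n)
      obtain ⟨S, hS, hSm⟩ := Set.Infinite.exists_subset_card_eq hinf m
      have := hcard S hS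
      rw [hSm] at this
      linarith
    set F := hfin.toFinset with hF
    have hmemF : ∀ θ, θ ∈ F ↔ θ ∈ 𝒞 := fun θ => hfin.mem_toFinset
    have hFcard := hcard F (by rw [hF, hfin.coe_toFinset])
    have hsum : ((integerPoints (n + 1) ∩ shell Q lam del).ncard : ℝ) ≤
        ∑ θ ∈ F, (latticeCount θ : ℝ) := by
      have h1 : integerPoints (n + 1) ∩ shell Q lam del =
          ⋃ θ ∈ F, integerPoints (n + 1) ∩ θ := by
        rw [← Set.inter_iUnion₂, ← h𝒞.sUnion_eq, Set.sUnion_eq_biUnion]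
        simp only [hmemF]
      rw [h1]
      exact_mod_cast Finset.set_ncard_biUnion_le F fun θ => integerPoints (n + 1) ∩ θ
    obtain ⟨J, hJ⟩ := pow_unbounded_of_one_lt ((∑ θ ∈ F, (latticeCount θ : ℝ)) / V)
      (by norm_num : (1 : ℝ) < 2)
    rw [div_lt_iff₀ hV0] at hJ
    have hpoint : ∀ θ ∈ F, (latticeCount θ : ℝ) ≤ K * (V + 1) + ∑ j ∈ Finset.range (J + 1),
        Set.indicator {θ | θ ∈ capClass lam del 𝒞 j ∧ K < 2 ^ j ∧ K < V * 2 ^ j}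
          (fun _ => V * 2 ^ j) θ := by
      intro θ hθ
      refine latticeCount_le_of_dyadic hV.symm hV0 hK ((hmemF θ).mp hθ) ?_
      have := Finset.single_le_sum (f := fun θ => (latticeCount θ : ℝ))
        (fun θ _ => Nat.cast_nonneg _) hθ
      linarith
    have hlevel : ∀ j ∈ Finset.range (J + 1), ∑ θ ∈ F,
        Set.indicator {θ | θ ∈ capClass lam del 𝒞 j ∧ K < 2 ^ j ∧ K < V * 2 ^ j}
          (fun _ => V * 2 ^ j) θ ≤ C₂ * M * D ^ n * q ^ j := by
      intro j _
      by_cases hgood : K < 2 ^ j ∧ K < V * 2 ^ j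
      -- For `k = n` the second largeness condition is exactly `K < V * 2 ^ j`.
      · obtain ⟨hcfin, hcn⟩ := hclass lam del hlam hdel hdel1 M 𝒞 h𝒞 n hn le_rfl j hgood.1 hgood.2
        have h1 : ∑ θ ∈ F, Set.indicator
            {θ | θ ∈ capClass lam del 𝒞 j ∧ K < 2 ^ j ∧ K < V * 2 ^ j} (fun _ => V * 2 ^ j) θ =
            ((F.filter fun θ => θ ∈ capClass lam del 𝒞 j).card : ℝ) * (V * 2 ^ j) := by
          rw [← nsmul_eq_mul, ← Finset.sum_const, Finset.sum_filter]
          refine Finset.sum_congr rfl fun θ _ => ?_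
          simp [Set.indicator_apply, hgood]
        have h2 : ((F.filter fun θ => θ ∈ capClass lam del 𝒞 j).card : ℝ) ≤
            ((capClass lam del 𝒞 j).ncard : ℝ) := by
          rw [← Set.ncard_coe_finset, Nat.cast_le]
          exact Set.ncard_le_ncard
            (fun θ hθ => (Finset.mem_filter.mp (Finset.mem_coe.mp hθ)).2) hcfin
        rw [h1]
        calc _ ≤ C₂ * M * ((2 : ℝ) ^ ((j : ℝ) / (n : ℝ)) * del) ^ (-((n + 1 : ℕ) : ℤ)) *
              (V * 2 ^ j) := by gcongr; exact h2.trans hcn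
          _ = C₂ * M * V * (2 ^ j *
              ((2 : ℝ) ^ ((j : ℝ) / (n : ℝ)) * del) ^ (-((n + 1 : ℕ) : ℤ))) := by ring
          _ = C₂ * M * D ^ n * q ^ j := by
              rw [two_pow_mul_rpow_zpow hn, hV, hRD, ← hq, mul_pow]
              field_simp
              ring
      · have h1 : ∀ θ ∈ F, Set.indicator
            {θ | θ ∈ capClass lam del 𝒞 j ∧ K < 2 ^ j ∧ K < V * 2 ^ j} (fun _ => V * 2 ^ j) θ = 0 :=
          fun θ _ => Set.indicator_of_notMem (fun h => hgood h.2) _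
        rw [Finset.sum_eq_zero h1]
        positivity
    have hgeom : ∑ j ∈ Finset.range (J + 1), q ^ j ≤ (1 - q)⁻¹ := by
      rw [← tsum_geometric_of_lt_one hq0 hq1]
      exact (summable_geometric_of_lt_one hq0 hq1).sum_le_tsum _ fun j _ => by positivity
    have hVD : D ^ n * V = del * lam ^ n := by
      rw [hV, ← mul_assoc, ← mul_pow, ← hlamR, div_mul_cancel₀ _ hR0.ne']
      ring
    have hDn : 0 < D ^ n := by positivity
    have hdl : 0 < del * lam ^ n := by positivity
    calc ((integerPoints (n + 1) ∩ shell Q lam del).ncard : ℝ)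
        ≤ ∑ θ ∈ F, (latticeCount θ : ℝ) := hsum
      _ ≤ ∑ θ ∈ F, (K * (V + 1) + ∑ j ∈ Finset.range (J + 1),
          Set.indicator {θ | θ ∈ capClass lam del 𝒞 j ∧ K < 2 ^ j ∧ K < V * 2 ^ j}
            (fun _ => V * 2 ^ j) θ) := Finset.sum_le_sum hpoint
      _ = F.card * (K * (V + 1)) + ∑ j ∈ Finset.range (J + 1), ∑ θ ∈ F,
          Set.indicator {θ | θ ∈ capClass lam del 𝒞 j ∧ K < 2 ^ j ∧ K < V * 2 ^ j}
            (fun _ => V * 2 ^ j) θ := by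
          rw [Finset.sum_add_distrib, Finset.sum_const, nsmul_eq_mul, Finset.sum_comm]
      _ ≤ M * (C₁ * 2 ^ n) * D ^ n * (K * (V + 1)) +
          ∑ j ∈ Finset.range (J + 1), C₂ * M * D ^ n * q ^ j := by
          gcongr with j hj
          exact hlevel j hj
      _ ≤ M * (C₁ * 2 ^ n) * D ^ n * (K * (V + 1)) + C₂ * M * D ^ n * (1 - q)⁻¹ := by
          rw [← Finset.mul_sum]
          gcongr
      _ = C₃ * (D ^ n * V + D ^ n) + C₄ * D ^ n := by rw [hC₃, hC₄]; ring
      _ = C₃ * (del * lam ^ n + D ^ n) + C₄ * D ^ n := by rw [hVD]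
      _ ≤ (N + C₃ + C₄) * (del * lam ^ n + D ^ n) := by
          have h1 : 0 ≤ N * (del * lam ^ n + D ^ n) := by positivity
          have h2 : 0 ≤ C₄ * (del * lam ^ n) := by positivity
          linarith

/-! ### Landau's range and the theorem -/

/-- In Landau's range the second term is dominated by the first. -/
lemma sqrt_div_pow_le_of_lt {d : ℕ} (hd : 2 ≤ d) {lam del : ℝ} (hlam : 1 ≤ lam)
    (h : lam ^ (-(((d : ℝ) - 1) / ((d : ℝ) + 1))) < del) :
    1 / lam ≤ del ∧ √(lam / del) ^ (d - 1) ≤ del * lam ^ (d - 1) := by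
  have hlam0 : 0 < lam := by linarith
  have hdel0 : 0 < del := (Real.rpow_pos_of_pos hlam0 _).trans h
  obtain ⟨n, rfl⟩ : ∃ n, d = n + 1 := ⟨d - 1, by omega⟩
  simp only [Nat.add_sub_cancel]
  push_cast at h
  have h0 : ((n : ℝ) + 1 - 1) / ((n : ℝ) + 1 + 1) = n / (n + 2) := by ring_nf
  rw [h0] at h
  constructor
  · refine le_trans ?_ h.le
    rw [one_div, ← Real.rpow_neg_one]
    apply Real.rpow_le_rpow_of_exponent_le hlam
    rw [neg_le_neg_iff, div_le_one (by positivity)]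
    linarith
  · refine le_of_sq_le_sq ?_ (by positivity)
    rw [← pow_mul, mul_comm n 2, pow_mul, Real.sq_sqrt (by positivity), div_pow,
      div_le_iff₀ (by positivity)]
    -- The range condition raised to the power `d + 1 = n + 2`, equivalent to the squared form of
    -- the inequality sought.
    have h1 : (lam ^ n)⁻¹ ≤ del ^ (n + 2) := by
      calc (lam ^ n)⁻¹ = (lam ^ (-((n : ℝ) / (n + 2)))) ^ (n + 2) := by
            rw [← Real.rpow_natCast _ (n + 2), ← Real.rpow_mul hlam0.le, ← Real.rpow_natCast,
              ← Real.rpow_neg hlam0.le]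
            congr 1
            push_cast
            field_simp
        _ ≤ del ^ (n + 2) := by gcongr
    have h2 : 1 ≤ lam ^ n * del ^ (n + 2) := by
      rwa [inv_le_iff_one_le_mul₀ (by positivity), mul_comm] at h1
    calc lam ^ n = lam ^ n * 1 := by ring
      _ ≤ lam ^ n * (lam ^ n * del ^ (n + 2)) := by gcongr
      _ = _ := by ring

end ThinShell

end

theorem mainTheorem5 (d : ℕ) (hd : 2 ≤ d)
    (Q : QuadraticForm ℝ (ThinShell.E d)) (hQ : Q.PosDef) :
    (∃ K : ℝ, 0 < K ∧ ∀ M : ℕ, ∃ C : ℝ, 0 < C ∧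
      ∀ lam del : ℝ, 1 ≤ lam → 1 / lam ≤ del → del < 1 →
      ∀ 𝒞 : Set (Set (ThinShell.E d)), ThinShell.IsCapDecomposition Q lam del M 𝒞 →
      ∀ k : ℕ, 1 ≤ k → k ≤ d - 1 → ∀ j : ℕ,
        K < (2 : ℝ) ^ j → K < √(del * lam) ^ k * del * (2 : ℝ) ^ j →
        (ThinShell.capClass lam del 𝒞 j).Finite ∧
        ((ThinShell.capClass lam del 𝒞 j).ncard : ℝ) ≤
          C * ((2 : ℝ) ^ ((j : ℝ) / (k : ℝ)) * del) ^ (-(d : ℤ))) ∧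
    (∃ C : ℝ, 0 < C ∧ ∀ lam del : ℝ, 1 ≤ lam → 1 / lam ≤ del → del < 1 →
      (ThinShell.integerPoints d ∩ ThinShell.shell Q lam del).Finite ∧
      ((ThinShell.integerPoints d ∩ ThinShell.shell Q lam del).ncard : ℝ) ≤
        C * (del * lam ^ (d - 1) + √(lam / del) ^ (d - 1))) ∧
    (∃ C : ℝ, 0 < C ∧ ∀ lam del : ℝ, 1 ≤ lam → del < 1 →
      lam ^ (-(((d : ℝ) - 1) / ((d : ℝ) + 1))) < del →
      (ThinShell.integerPoints d ∩ ThinShell.shell Q lam del).Finite ∧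
      ((ThinShell.integerPoints d ∩ ThinShell.shell Q lam del).ncard : ℝ) ≤
        C * (del * lam ^ (d - 1))) := by
  obtain ⟨A, hA⟩ := ThinShell.exists_norm_sq_eq Q hQ
  obtain ⟨K, C₁, hK, hC₁, hclass⟩ := ThinShell.exists_ncard_capClass_le (by omega) hA
  obtain ⟨C₂, hC₂, hshell⟩ := ThinShell.exists_ncard_integerPoints_shell_le hd hA
  have hfin := ThinShell.finite_integerPoints_inter_shell hA
  -- `M + 1` keeps the constant positive when `M = 0`.
  refine ⟨⟨K, by linarith, fun M => ⟨C₁ * (M + 1), by positivity, ?_⟩⟩,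
    ⟨C₂, hC₂, fun lam del hlam hdel hdel1 => ⟨hfin lam del, hshell lam del hlam hdel hdel1⟩⟩,
    ⟨C₂ * 2, by positivity, fun lam del hlam hdel1 hdel => ⟨hfin lam del, ?_⟩⟩⟩
  · intro lam del hlam hdel hdel1 𝒞 h𝒞 k hk hkd j hj hjR
    rw [mul_comm del lam] at hjR
    obtain ⟨h1, h2⟩ := hclass lam del hlam hdel hdel1 M 𝒞 h𝒞 k hk (by omega) j hj hjR
    refine ⟨h1, h2.trans ?_⟩
    have hdel0 : 0 < del := lt_of_lt_of_le (by positivity) hdel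
    gcongr
    linarith
  · obtain ⟨h1, h2⟩ := ThinShell.sqrt_div_pow_le_of_lt hd hlam hdel
    refine (hshell lam del hlam h1 hdel1).trans ?_
    rw [mul_assoc]
    gcongr
    linarith
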